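/- Consider the following decision problem. Given a finite simple graph $G$ (no loops, no multiple edges) and an integer $k\ge 0$, is there a set $X\subseteq V(G)$ with $|X|\le k$ such that $G-X$ is $2$-edge-colorable, that is, such that the edges of $G-X$ can be assigned colors from a set of two colors so that any two distinct edges with a common end vertex receive different colors? This problem is fixed-parameter tractable with respect to $k$: there are a computable function $f$, a polynomial $p$ and a single algorithm that decides every instance $(G,k)$ correctly in at most $f(k)\cdot p(\mathrm{size})$ steps. Moreover, it can be solved in time $2^{(k+1)^2+k}\cdot \mathrm{poly}(\mathrm{size})$: there are a polynomial $q$ and a single algorithm that decides every instance $(G,k)$ correctly in at most $2^{(k+1)^2+k}\cdot q(\mathrm{size})$ steps. Here an algorithm is a program of a random access machine whose elementary operations (constants, copying, addition, truncated subtraction, indirect loading and storing, tests for zero) cost one step each. The instance is given as the numbers $|V(G)|$ and $k$ followed by the adjacency matrix of $G$, and $\mathrm{size}$ is the total length of these numbers in binary, counting one separator after each number. -/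

import Mathlib

/-! ## Random access machines with a step count -/

namespace RAM

/-- A state of the machine: the processor registers, addressed only by constants of the program,
and the memory cells, addressed through the contents of registers. -/
structure State where
  reg : ℕ → ℕ
  mem : ℕ → ℕ

/-- Overwrite the register `d`. -/
def State.setReg (s : State) (d v : ℕ) : State := { s with reg := Function.update s.reg d v }

/-- Overwrite the memory cell `a`. -/
def State.setMem (s : State) (a v : ℕ) : State := { s with mem := Function.update s.mem a v }

/-- The elementary instructions. The only arithmetic is addition and truncated subtraction. -/
inductive Instr where
  /-- `R_d := c` -/
  | const (d c : ℕ)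
  /-- `R_d := R_a` -/
  | copy (d a : ℕ)
  /-- `R_d := R_a + R_b` -/
  | add (d a b : ℕ)
  /-- `R_d := max (R_a - R_b) 0` -/
  | sub (d a b : ℕ)
  /-- `R_d := M[R_a]` -/
  | load (d a : ℕ)
  /-- `M[R_a] := R_b` -/
  | store (a b : ℕ)

/-- The effect of one elementary instruction. -/
def Instr.run : Instr → State → State
  | .const d c, s => s.setReg d c
  | .copy d a, s => s.setReg d (s.reg a)
  | .add d a b, s => s.setReg d (s.reg a + s.reg b)
  | .sub d a b, s => s.setReg d (s.reg a - s.reg b)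
  | .load d a, s => s.setReg d (s.mem (s.reg a))
  | .store a b, s => s.setMem (s.reg a) (s.reg b)

/-- Programs: a program is a fixed finite object, independent of the input. -/
inductive Program where
  | instr (i : Instr)
  | seq (P Q : Program)
  /-- if `R_a ≠ 0` then `P` else `Q` -/
  | branch (a : ℕ) (P Q : Program)
  /-- while `R_a ≠ 0` do `P` -/
  | loop (a : ℕ) (P : Program)

/-- `Exec P s t s'`: started in the state `s`, the program `P` halts in the state `s'` after exactly
`t` steps. Every elementary instruction and every evaluation of a test is one step. -/
inductive Exec : Program → State → ℕ → State → Prop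
  | instr (i : Instr) (s : State) : Exec (.instr i) s 1 (i.run s)
  | seq {P Q : Program} {s s₁ s₂ : State} {t₁ t₂ : ℕ} :
      Exec P s t₁ s₁ → Exec Q s₁ t₂ s₂ → Exec (.seq P Q) s (t₁ + t₂) s₂
  | branchTrue {a : ℕ} {P Q : Program} {s s' : State} {t : ℕ} :
      s.reg a ≠ 0 → Exec P s t s' → Exec (.branch a P Q) s (t + 1) s'
  | branchFalse {a : ℕ} {P Q : Program} {s s' : State} {t : ℕ} :
      s.reg a = 0 → Exec Q s t s' → Exec (.branch a P Q) s (t + 1) s'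
  | loopDone {a : ℕ} {P : Program} {s : State} :
      s.reg a = 0 → Exec (.loop a P) s 1 s
  | loopStep {a : ℕ} {P : Program} {s s₁ s₂ : State} {t₁ t₂ : ℕ} :
      s.reg a ≠ 0 → Exec P s t₁ s₁ → Exec (.loop a P) s₁ t₂ s₂ →
      Exec (.loop a P) s (t₁ + t₂ + 1) s₂

/-- The machine is deterministic: the final state and the number of steps are determined. -/
theorem Exec.deterministic {P : Program} {s s₁ s₂ : State} {t₁ t₂ : ℕ}
    (h₁ : Exec P s t₁ s₁) (h₂ : Exec P s t₂ s₂) : t₁ = t₂ ∧ s₁ = s₂ := by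
  induction h₁ generalizing t₂ s₂ with
  | instr i s => cases h₂; exact ⟨rfl, rfl⟩
  | seq _ _ ihP ihQ =>
    cases h₂ with
    | seq hP hQ =>
      obtain ⟨rfl, rfl⟩ := ihP hP
      obtain ⟨rfl, rfl⟩ := ihQ hQ
      exact ⟨rfl, rfl⟩
  | branchTrue h _ ih =>
    cases h₂ with
    | branchTrue _ hP => obtain ⟨rfl, rfl⟩ := ih hP; exact ⟨rfl, rfl⟩
    | branchFalse h' _ => exact absurd h' h
  | branchFalse h _ ih =>
    cases h₂ with
    | branchTrue h' _ => exact absurd h h'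
    | branchFalse _ hQ => obtain ⟨rfl, rfl⟩ := ih hQ; exact ⟨rfl, rfl⟩
  | loopDone h =>
    cases h₂ with
    | loopDone _ => exact ⟨rfl, rfl⟩
    | loopStep h' _ _ => exact absurd h h'
  | loopStep h _ _ ihP ihL =>
    cases h₂ with
    | loopDone h' => exact absurd h' h
    | loopStep _ hP hL =>
      obtain ⟨rfl, rfl⟩ := ihP hP
      obtain ⟨rfl, rfl⟩ := ihL hL
      exact ⟨rfl, rfl⟩

/-- The initial state on an input word `w`: the entries of `w` stand in the memory cells
`0, …, w.length - 1`, register `0` holds `w.length`, and everything else is `0`. -/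
def initial (w : List ℕ) : State where
  reg := fun r => if r = 0 then w.length else 0
  mem := fun a => w.getD a 0

/-- The length of an input word: the entries are written in binary, each followed by a
separator. -/
def inputSize (w : List ℕ) : ℕ := (w.map fun x => Nat.size x + 1).sum

end RAM

/-! ## Parameterized decision problems -/

/-- A parameterized decision problem: instances with an (injective) encoding as input words,
a parameter, and the set of yes-instances. -/
structure ParamProblem where
  Inst : Type
  encode : Inst → List ℕ
  encode_injective : Function.Injective encode
  param : Inst → ℕ
  Yes : Inst → Prop

namespace ParamProblem

/-- The length of (the encoding of) an instance. -/
def size (L : ParamProblem) (x : L.Inst) : ℕ := RAM.inputSize (L.encode x)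

/-- A single program halts on every instance `x` within `T x` steps, with the correct answer
(`1` for yes, `0` for no) in register `0`. -/
def SolvableInTime (L : ParamProblem) (T : L.Inst → ℕ) : Prop :=
  ∃ P : RAM.Program, ∀ x : L.Inst, ∃ (t : ℕ) (s : RAM.State),
    RAM.Exec P (RAM.initial (L.encode x)) t s ∧ t ≤ T x ∧
      (L.Yes x → s.reg 0 = 1) ∧ (¬ L.Yes x → s.reg 0 = 0)

/-- Solvable in time `f(param) · poly(size)`. -/
def SolvableInFPTTime (L : ParamProblem) (f : ℕ → ℕ) : Prop :=
  ∃ p : Polynomial ℕ, L.SolvableInTime fun x => f (L.param x) * p.eval (L.size x)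

/-- Fixed-parameter tractability: solvable in time `f(param) · poly(size)` for some computable
function `f`. -/
def IsFPT (L : ParamProblem) : Prop :=
  ∃ f : ℕ → ℕ, Computable f ∧ L.SolvableInFPTTime f

end ParamProblem

/-! ## Deleting vertices to get a 2-edge-colorable graph -/

/-- `G` is `c`-edge-colorable: its edges can be assigned colors from a set of `c` colors so that
distinct edges with a common end vertex receive different colors. -/
def SimpleGraph.EdgeColorable {V : Type*} (G : SimpleGraph V) (c : ℕ) : Prop :=
  ∃ f : G.edgeSet → Fin c, ∀ e₁ e₂ : G.edgeSet, e₁ ≠ e₂ →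
    (∃ v : V, v ∈ (e₁ : Sym2 V) ∧ v ∈ (e₂ : Sym2 V)) → f e₁ ≠ f e₂

/-- An instance: a finite simple graph and a budget. -/
structure GraphBudget where
  n : ℕ
  G : SimpleGraph (Fin n)
  k : ℕ

namespace GraphBudget

open Classical in
/-- The input word `n, k, a₀, …, a_{n²-1}`: the number of vertices, the budget and the adjacency
matrix, row by row. -/
noncomputable def encode (x : GraphBudget) : List ℕ :=
  x.n :: x.k :: List.ofFn fun p : Fin (x.n * x.n) => if x.G.Adj p.divNat p.modNat then 1 else 0

theorem encode_injective : Function.Injective encode := by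
  rintro ⟨n, G, k⟩ ⟨n', G', k'⟩ h
  simp only [encode, List.cons.injEq] at h
  obtain ⟨rfl, rfl, h⟩ := h
  have h' := List.ofFn_injective h
  congr 1
  ext i j
  have := congrFun h' (finProdFinEquiv (i, j))
  have e := finProdFinEquiv.symm_apply_apply (i, j)
  simp only [finProdFinEquiv_symm_apply, Prod.mk.injEq] at e
  rw [e.1, e.2] at this
  by_cases h₁ : G.Adj i j <;> by_cases h₂ : G'.Adj i j <;> simp_all

/-- There is a set `X` of at most `k` vertices such that `G - X` is 2-edge-colorable. -/
def Yes (x : GraphBudget) : Prop :=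
  ∃ X : Finset (Fin x.n), X.card ≤ x.k ∧ (x.G.induce {v | v ∉ X}).EdgeColorable 2

end GraphBudget

/-- Given a graph `G` and an integer `k`, can at most `k` vertices be deleted from `G` so that the
remaining graph is 2-edge-colorable? The parameter is `k`. -/
noncomputable def vertexDeletionTwoEdgeColoring : ParamProblem where
  Inst := GraphBudget
  encode := GraphBudget.encode
  encode_injective := GraphBudget.encode_injective
  param := GraphBudget.k
  Yes := GraphBudget.Yes

/-! A graph is 2-edge-colorable iff every vertex has at most two neighbors and no closed walk is odd
(`edgeColorable_two_iff`). This gives a search tree with four branches per node. If a vertex has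
three neighbors, every solution contains it or one of these three. If all degrees are at most 2, an
odd closed walk lies in a component that is an odd cycle; a solution must hit this cycle, and which
vertex it hits is irrelevant, so any vertex of the walk may be deleted (`exists_exchange`). In both
cases some branch lowers the size of a solution by one (`exists_branch`).

At most `k` deletions and a final test make `k + 1` rounds, so the branches are numbered by `q < 4 ^
(k + 1)`, the base-four digits of `q` being the guesses (`yes_iff_search`). The vertex to delete is
found in polynomially many steps: degrees by counting neighbors, odd closed walks by tabulating the
numbers of walks of each length up to `n`. These numbers may be large, but an addition is one step.

The program is written with counting loops only, so that halting and running time (`exec_compile`)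
follow by structural induction, and correctness by loop invariants (`eval_loop_invariant`). The
machine cannot divide; splitting off a digit is done by counting and takes `O(4 ^ (k + 1))` steps.
The total is `(k + 1) * (4 ^ (k + 1)) ^ 2` times a polynomial in `n`, which `bound_le` compares with
`2 ^ ((k + 1) ^ 2 + k)`. -/

/-! ## Odd cycles and 2-edge-colorings -/

namespace SimpleGraph

variable {V : Type*} {G : SimpleGraph V}

/-- A graph with a closed walk of odd length has a cycle of odd length. -/
theorem Walk.exists_odd_cycle {u : V} (w : G.Walk u u) (hw : Odd w.length) :
    ∃ (v : V) (c : G.Walk v v), c.IsCycle ∧ Odd c.length := by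
  induction hm : w.length using Nat.strong_induction_on generalizing u with
  | _ m ih =>
    subst hm
    by_cases hlt : ∃ (v : V) (c : G.Walk v v), Odd c.length ∧ c.length < w.length
    · obtain ⟨v, c, hc, hcl⟩ := hlt
      exact ih _ hcl c hc rfl
    push Not at hlt
    refine ⟨u, w, Walk.isCycle_iff_isPath_tail_and_le_length.2 ⟨?_, ?_⟩, hw⟩
    · rw [← Walk.IsPath.getVert_injOn_iff]
      -- A repeated vertex cuts `w` into two shorter closed walks whose lengths add up to that of
      -- `w`. One of them is odd, against minimality.
      have key : ∀ i j, i < j → j < w.length → w.getVert (i + 1) ≠ w.getVert (j + 1) := by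
        intro i j hij hj he
        have he' : (w.drop (i + 1)).getVert (j - i) = w.getVert (i + 1) := by
          rw [Walk.drop_getVert, he]; congr 1; omega
        let c₁ : G.Walk (w.getVert (i + 1)) (w.getVert (i + 1)) :=
          ((w.drop (i + 1)).take (j - i)).copy rfl he'
        let c₂ : G.Walk u u := (w.take (i + 1)).append ((w.drop (j + 1)).copy he.symm rfl)
        have h₁ : c₁.length = j - i := by
          simp only [c₁, Walk.length_copy, Walk.take_length, Walk.drop_length]; omega
        have h₂ : c₂.length = w.length - (j - i) := by
          simp only [c₂, Walk.length_append, Walk.length_copy, Walk.take_length,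
            Walk.drop_length]; omega
        rcases Nat.even_or_odd (j - i) with h | h
        · have := hlt u c₂ (by rw [h₂]; exact Nat.Odd.sub_even (by omega) hw h)
          omega
        · have := hlt _ c₁ (by rw [h₁]; exact h)
          omega
      have hlen : w.tail.length = w.length - 1 := by simp
      have hpos := hw.pos
      intro i hi j hj hij
      simp only [Set.mem_ofPred_eq, hlen] at hi hj
      simp only [Walk.getVert_tail] at hij
      rcases lt_trichotomy i j with h | h | h
      · exact absurd hij (key i j h (by omega))
      · exact h
      · exact absurd hij.symm (key j i h (by omega))
    · by_contra hlen
      -- An odd length below 3 is 1, and a closed walk of length 1 would be a loop.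
      have h1 : w.length = 1 := by
        obtain ⟨r, hr⟩ := hw
        omega
      exact (Walk.adj_of_length_eq_one h1).ne rfl

/-- The vertices of a cycle, as a periodic sequence. -/
theorem Walk.IsCycle.exists_periodic {u : V} {c : G.Walk u u} (hc : c.IsCycle) :
    ∃ s : ℕ → V, (∀ i, G.Adj (s i) (s (i + 1))) ∧ (∀ i, s i ≠ s (i + 2)) ∧
      ∀ i, s (i + c.length) = s i := by
  have h3 := hc.three_le_length
  have hpos : 0 < c.length := by omega
  have hsucc : ∀ i, c.getVert ((i + 1) % c.length) = c.getVert (i % c.length + 1) := by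
    intro i
    rw [Nat.add_mod, Nat.mod_eq_of_lt (show 1 < c.length by omega)]
    have := Nat.mod_lt i hpos
    rcases (show i % c.length + 1 ≤ c.length by omega).lt_or_eq with h | h
    · rw [Nat.mod_eq_of_lt h]
    · rw [h, Nat.mod_self]; simp
  refine ⟨fun i => c.getVert (i % c.length), fun i => ?_, fun i h => ?_, fun i => by simp⟩
  · beta_reduce
    rw [hsucc]
    exact c.adj_getVert_succ (Nat.mod_lt _ hpos)
  · have hi := Nat.mod_lt i hpos
    have hj := Nat.mod_lt (i + 2) hpos
    have := hc.getVert_injOn' (by simp only [Set.mem_ofPred_eq]; omega)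
      (by simp only [Set.mem_ofPred_eq]; omega) h
    have h2 := (Nat.add_mod i 2 c.length)
    rw [Nat.mod_eq_of_lt (show 2 < c.length by omega)] at h2
    rcases lt_or_ge (i % c.length + 2) c.length with h' | h'
    · rw [Nat.mod_eq_of_lt h'] at h2; omega
    · have h4 : (i % c.length + 2) % c.length = i % c.length + 2 - c.length := by
        rw [Nat.mod_eq_sub_mod h', Nat.mod_eq_of_lt (by omega)]
      omega

/-- With two colors, alternation forces period 2; an odd period would then make the sequence
constant. -/
theorem not_odd_periodic_alternating (f : ℕ → Fin 2) (hf : ∀ i, f i ≠ f (i + 1)) (m : ℕ)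
    (hm : Odd m) (hper : ∀ i, f (i + m) = f i) : False := by
  have h2 : ∀ i, f (i + 2) = f i := fun i => by
    have := hf i; have := hf (i + 1); have : f (i + 1 + 1) = f (i + 2) := rfl; omega
  have h2r : ∀ r i, f (i + 2 * r) = f i := by
    intro r
    induction r with
    | zero => simp
    | succ r ih => intro i; rw [← ih i, ← h2 (i + 2 * r)]; congr 1
  obtain ⟨r, rfl⟩ := hm
  have h := hper 0
  rw [show 0 + (2 * r + 1) = 1 + 2 * r by ring, h2r] at h
  exact hf 0 h.symm

/-- This makes the closed-walk criterion for 2-colorability of vertices available for edges. -/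
theorem edgeColorable_iff_lineGraph_colorable {c : ℕ} :
    G.EdgeColorable c ↔ G.lineGraph.Colorable c := by
  constructor
  · rintro ⟨f, hf⟩
    refine ⟨Coloring.mk f fun {a b} h => ?_⟩
    rw [lineGraph_adj_iff_exists] at h
    exact hf a b h.1 h.2
  · rintro ⟨f⟩
    exact ⟨f, fun a b hne h => f.valid (lineGraph_adj_iff_exists.2 ⟨hne, h⟩)⟩

/-- Every vertex has at most two neighbors. -/
def DegreeLeTwo (G : SimpleGraph V) : Prop :=
  ∀ v a b c, G.Adj v a → G.Adj v b → G.Adj v c → a ≠ b → a ≠ c → b ≠ c → False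

/-- Every closed walk has even length. -/
def LoopsEven (G : SimpleGraph V) : Prop :=
  ∀ u, ∀ w : G.Walk u u, Even w.length

theorem DegreeLeTwo.mono {H : SimpleGraph V} (h : H ≤ G) (hG : G.DegreeLeTwo) :
    H.DegreeLeTwo :=
  fun v a b c ha hb hc => hG v a b c (h ha) (h hb) (h hc)

theorem LoopsEven.mono {H : SimpleGraph V} (h : H ≤ G) (hG : G.LoopsEven) : H.LoopsEven := by
  intro u w
  simpa using hG u (w.mapLe h)

theorem EdgeColorable.degreeLeTwo (h : G.EdgeColorable 2) : G.DegreeLeTwo := by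
  obtain ⟨f, hf⟩ := h
  intro v a b c ha hb hc hab hac hbc
  have key : ∀ x y (hx : G.Adj v x) (hy : G.Adj v y), x ≠ y →
      f ⟨s(v, x), hx⟩ ≠ f ⟨s(v, y), hy⟩ := fun x y hx hy hne =>
    hf _ _ (fun h => hne (Sym2.congr_right.1 (congrArg Subtype.val h))) ⟨v, by simp, by simp⟩
  have := key a b ha hb hab
  have := key a c ha hc hac
  have := key b c hb hc hbc
  omega

theorem EdgeColorable.loopsEven (h : G.EdgeColorable 2) : G.LoopsEven := by
  obtain ⟨f, hf⟩ := h
  intro u w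
  by_contra hw
  obtain ⟨v, c, hc, hodd⟩ := w.exists_odd_cycle (Nat.not_even_iff_odd.1 hw)
  obtain ⟨s, hadj, hne, hper⟩ := hc.exists_periodic
  refine not_odd_periodic_alternating (fun i => f ⟨s(s i, s (i + 1)), hadj i⟩) (fun i => ?_) _
    hodd (fun i => ?_)
  · refine hf _ _ (fun h => ?_) ⟨s (i + 1), by simp, by simp⟩
    replace h := congrArg Subtype.val h
    simp only [Sym2.eq_iff] at h
    rcases h with ⟨h, -⟩ | ⟨h, -⟩
    · exact (hadj i).ne h
    · exact hne i h
  · have h1 : s (i + c.length + 1) = s (i + 1) := by rw [← hper (i + 1)]; congr 1; ring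
    simp only [hper, h1]

/-- An odd cycle in the line graph is a cyclic sequence of edges, consecutive ones sharing a vertex.
By the degree bound consecutive shared vertices differ, so they are the two ends of an edge. They
form an odd closed sequence of adjacent vertices, which a 2-coloring of the vertices of `G`
excludes. -/
theorem edgeColorable_two_of (hd : G.DegreeLeTwo) (he : G.LoopsEven) : G.EdgeColorable 2 := by
  rw [edgeColorable_iff_lineGraph_colorable, two_colorable_iff_forall_loop_even]
  intro e w
  by_contra hw
  obtain ⟨f⟩ := two_colorable_iff_forall_loop_even.2 he
  obtain ⟨e', c, hc, hodd⟩ := w.exists_odd_cycle (Nat.not_even_iff_odd.1 hw)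
  obtain ⟨s, hadj, hne, hper⟩ := hc.exists_periodic
  -- The shared vertex is chosen as a function of the two edges, with a junk value for nonadjacent
  -- ones, so that it inherits the periodicity of `s`.
  have hex : ∀ a b : G.edgeSet, ∃ v : V, G.lineGraph.Adj a b →
      v ∈ (a : Sym2 V) ∧ v ∈ (b : Sym2 V) := by
    intro a b
    by_cases h : G.lineGraph.Adj a b
    · obtain ⟨v, hv⟩ := (lineGraph_adj_iff_exists.1 h).2
      exact ⟨v, fun _ => hv⟩
    · exact ⟨(Quot.out (a : Sym2 V)).1, fun h' => absurd h' h⟩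
  choose g hg using hex
  have hv : ∀ i, g (s i) (s (i + 1)) ∈ (s i : Sym2 V) ∧
      g (s i) (s (i + 1)) ∈ (s (i + 1) : Sym2 V) := fun i => hg _ _ (hadj i)
  have h1 : ∀ i, s (i + c.length + 1) = s (i + 1) := fun i => by
    rw [← hper (i + 1)]; congr 1; ring
  refine not_odd_periodic_alternating (fun i => f (g (s i) (s (i + 1)))) (fun i => ?_) _
    hodd (fun i => by simp only [hper, h1])
  -- Otherwise three distinct edges would meet in one vertex.
  have hvv : g (s i) (s (i + 1)) ≠ g (s (i + 1)) (s (i + 1 + 1)) := by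
    intro h
    obtain ⟨ha, hb⟩ := hv i
    have hc := (hv (i + 1)).2
    rw [← h] at hc
    set v := g (s i) (s (i + 1))
    obtain ⟨x, hx⟩ := ha
    obtain ⟨y, hy⟩ := hb
    obtain ⟨z, hz⟩ := hc
    refine hd v x y z ?_ ?_ ?_ ?_ ?_ ?_
    · rw [← mem_edgeSet, ← hx]; exact (s i).2
    · rw [← mem_edgeSet, ← hy]; exact (s (i + 1)).2
    · rw [← mem_edgeSet, ← hz]; exact (s (i + 1 + 1)).2
    · rintro rfl; exact (hadj i).ne (Subtype.ext (hx.trans hy.symm))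
    · rintro rfl; exact hne i (Subtype.ext (hx.trans hz.symm))
    · rintro rfl; exact (hadj (i + 1)).ne (Subtype.ext (hy.trans hz.symm))
  have he : (s (i + 1) : Sym2 V) = s(g (s i) (s (i + 1)), g (s (i + 1)) (s (i + 1 + 1))) :=
    (Sym2.mem_and_mem_iff hvv).1 ⟨(hv i).2, (hv (i + 1)).1⟩
  refine f.valid ?_
  rw [← mem_edgeSet, ← he]
  exact (s (i + 1)).2

/-- A graph is 2-edge-colorable iff every vertex has at most two neighbors and there is no closed
walk of odd length. -/
theorem edgeColorable_two_iff : G.EdgeColorable 2 ↔ G.DegreeLeTwo ∧ G.LoopsEven :=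
  ⟨fun h => ⟨h.degreeLeTwo, h.loopsEven⟩, fun h => edgeColorable_two_of h.1 h.2⟩

theorem EdgeColorable.comap {W : Type*} {H : SimpleGraph W} {c : ℕ} (φ : H ↪g G)
    (h : G.EdgeColorable c) : H.EdgeColorable c := by
  rw [edgeColorable_iff_lineGraph_colorable] at h ⊢
  exact h.of_hom φ.toCopy.lineGraph.toHom

/-- In a graph in which every vertex has at most two neighbors, a cycle absorbs everything that is
reachable from it. -/
theorem Walk.IsCycle.mem_support_of_reachable (hd : G.DegreeLeTwo) {u x y : V} {c : G.Walk u u}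
    (hc : c.IsCycle) (hx : x ∈ c.support) (hxy : G.Reachable x y) : y ∈ c.support := by
  obtain ⟨w⟩ := hxy
  induction w with
  | nil => exact hx
  | @cons a b _ hab _ ih =>
    refine ih ?_
    -- The cycle already supplies two neighbors of `a`, so `b` must be one of them.
    obtain ⟨p, q, hpq, hset⟩ := Set.ncard_eq_two.1 (hc.ncard_neighborSet_toSubgraph_eq_two hx)
    have hp : c.toSubgraph.Adj a p := by
      rw [← Subgraph.mem_neighborSet, hset]; simp
    have hq : c.toSubgraph.Adj a q := by
      rw [← Subgraph.mem_neighborSet, hset]; simp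
    by_cases h1 : b = p
    · subst h1; exact c.mem_support_of_adj_toSubgraph hp.symm
    by_cases h2 : b = q
    · subst h2; exact c.mem_support_of_adj_toSubgraph hq.symm
    exact (hd a b p q hab hp.adj_sub hq.adj_sub h1 h2 hpq).elim

/-- The graph in which the vertices of `D` have been isolated. -/
def isolate (G : SimpleGraph V) (D : Set V) : SimpleGraph V where
  Adj v w := G.Adj v w ∧ v ∉ D ∧ w ∉ D
  symm := ⟨fun _ _ h => ⟨h.1.symm, h.2.2, h.2.1⟩⟩
  loopless := ⟨fun _ h => h.1.ne rfl⟩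

theorem isolate_anti {D E : Set V} (h : D ⊆ E) : G.isolate E ≤ G.isolate D :=
  fun _ _ hvw => ⟨hvw.1, fun hv => hvw.2.1 (h hv), fun hw => hvw.2.2 (h hw)⟩

/-- Isolated vertices carry no edges. Isolating instead of deleting keeps the vertex type fixed
while the deleted set grows. -/
theorem edgeColorable_induce_iff {D : Set V} :
    (G.induce {v | v ∉ D}).EdgeColorable 2 ↔ (G.isolate D).EdgeColorable 2 := by
  let φ : G.induce {v | v ∉ D} ↪g G.isolate D :=
    { toFun := Subtype.val
      inj' := Subtype.val_injective
      map_rel_iff' := by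
        rintro ⟨a, ha⟩ ⟨b, hb⟩
        exact ⟨fun h => h.1, fun h => ⟨h, ha, hb⟩⟩ }
  refine ⟨?_, fun h => h.comap φ⟩
  rintro ⟨f, hf⟩
  have hmem : ∀ e : (G.isolate D).edgeSet, ∃ e' : (G.induce {v | v ∉ D}).edgeSet,
      Sym2.map Subtype.val e'.1 = (e : Sym2 V) := by
    rintro ⟨⟨a, b⟩, h⟩
    exact ⟨⟨s(⟨a, h.2.1⟩, ⟨b, h.2.2⟩), h.1⟩, rfl⟩
  choose g hg using hmem
  refine ⟨fun e => f (g e), fun e₁ e₂ hne ⟨v, h₁, h₂⟩ => hf _ _ (fun h => hne ?_) ?_⟩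
  · exact Subtype.ext (by rw [← hg, ← hg, h])
  · rw [← hg, Sym2.mem_map] at h₁ h₂
    obtain ⟨a, ha, rfl⟩ := h₁
    obtain ⟨b, hb, hab⟩ := h₂
    exact ⟨a, ha, by rwa [← Subtype.ext hab]⟩

theorem Walk.mem_support_not_mem_isolate {D : Set V} {u x : V} {c : (G.isolate D).Walk u u}
    (hc : ¬ c.Nil) (hx : x ∈ c.support) : x ∉ D := by
  obtain ⟨e, he, hxe⟩ := (Walk.mem_support_iff_exists_mem_edges_of_not_nil hc).1 hx
  induction e with
  | _ a b =>
    have := c.adj_of_mem_edges he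
    rcases Sym2.mem_iff.1 hxe with rfl | rfl
    · exact this.2.1
    · exact this.2.2

/-- The vertices on an odd closed walk of a graph of maximum degree at most 2 are interchangeable:
each of them can replace a vertex of any solution. -/
theorem exists_exchange [DecidableEq V] {D X : Set V} (hd : (G.isolate D).DegreeLeTwo) {u : V}
    (w : (G.isolate D).Walk u u) (hw : Odd w.length)
    (hX : (G.isolate (D ∪ X)).EdgeColorable 2) :
    ∃ x ∈ X, (G.isolate (insert u D ∪ (X \ {x}))).EdgeColorable 2 := by
  have hX' := hX.loopsEven
  -- An odd closed walk that misses `X` would survive in `G.isolate (D ∪ X)`.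
  have havoid : ∀ (v : V) (c : (G.isolate D).Walk v v), Odd c.length →
      ∃ x ∈ X, x ∈ c.support := by
    intro v c hc
    by_contra hno
    push Not at hno
    have := hX' v (c.transfer _ (fun e he => by
      induction e with
      | _ a b =>
        have h := c.adj_of_mem_edges he
        have ha := fun h' => hno a h' (c.fst_mem_support_of_mem_edges he)
        have hb := fun h' => hno b h' (c.snd_mem_support_of_mem_edges he)
        exact ⟨h.1, fun h' => h'.elim h.2.1 ha, fun h' => h'.elim h.2.2 hb⟩))
    rw [Walk.length_transfer] at this
    exact (Nat.not_even_iff_odd.2 hc) this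
  obtain ⟨x, hxX, hxw⟩ := havoid u w hw
  have hle : G.isolate (insert u D ∪ (X \ {x})) ≤ G.isolate D :=
    isolate_anti fun _ h => Or.inl (Or.inr h)
  refine ⟨x, hxX, edgeColorable_two_of (hd.mono hle) fun v p => ?_⟩
  by_contra hp
  obtain ⟨v, c, hc, hodd⟩ := p.exists_odd_cycle (Nat.not_even_iff_odd.1 hp)
  obtain ⟨y, hyX, hyc⟩ := havoid v (c.mapLe hle) (by simpa using hodd)
  have hyc' : y ∈ c.support := by simpa using hyc
  have hy := Walk.mem_support_not_mem_isolate hc.not_nil hyc'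
  have hyx : y = x := by
    by_contra hne
    exact hy (Or.inr ⟨hyX, hne⟩)
  subst hyx
  -- The remaining odd cycle passes through `x`, which is joined to `u` by `w`. Hence it absorbs
  -- `u`, although `u` has been isolated.
  have hu := ((Walk.isCycle_mapLe hle).2 hc).mem_support_of_reachable hd hyc
    ⟨(w.takeUntil y hxw).reverse⟩
  have hu' : u ∈ c.support := by simpa using hu
  exact Walk.mem_support_not_mem_isolate hc.not_nil hu' (Or.inl (Or.inl rfl))

end SimpleGraph

/-! ## Structured programs with counting loops -/

namespace RAM

/-- Programs whose only loops are counting loops with a fixed number of rounds. Register `1` is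
reserved for the loop tests. -/
inductive CountProgram where
  | instr (i : Instr)
  | seq (P Q : CountProgram)
  | branch (a : ℕ) (P Q : CountProgram)
  /-- `for R_c := 0, …, R_b - 1 do P` -/
  | loop (c b : ℕ) (P : CountProgram)

namespace CountProgram

/-- The register that an instruction may change, if any. -/
def _root_.RAM.Instr.writes : Instr → List ℕ
  | .const d _ | .copy d _ | .add d _ _ | .sub d _ _ | .load d _ => [d]
  | .store _ _ => []

/-- The registers that a program may change. -/
def writes : CountProgram → List ℕ
  | instr i => i.writes
  | seq P Q => P.writes ++ Q.writes
  | branch _ P Q => P.writes ++ Q.writes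
  | loop c _ P => c :: 1 :: P.writes

/-- The registers that bound the number of rounds of the loops. -/
def bounds : CountProgram → List ℕ
  | instr _ => []
  | seq P Q => P.bounds ++ Q.bounds
  | branch _ P Q => P.bounds ++ Q.bounds
  | loop _ b P => b :: P.bounds

/-- The program does not change the memory. -/
def readOnly : CountProgram → Bool
  | instr (.store _ _) => false
  | instr _ => true
  | seq P Q => P.readOnly && Q.readOnly
  | branch _ P Q => P.readOnly && Q.readOnly
  | loop _ _ P => P.readOnly

/-- No loop changes its own counter or bound. -/
def wellFormed : CountProgram → Bool
  | instr _ => true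
  | seq P Q => P.wellFormed && Q.wellFormed
  | branch _ P Q => P.wellFormed && Q.wellFormed
  | loop c b P => P.wellFormed && (c != 1) && (b != 1) && (c != b) && !(P.writes.contains c) &&
      !(P.writes.contains b)

/-- Set up a loop. -/
def loopInit (c b : ℕ) (s : State) : State := (Instr.sub 1 b c).run ((Instr.const c 0).run s)

/-- Finish one round of a loop. -/
def loopNext (c b : ℕ) (s : State) : State :=
  (Instr.sub 1 b c).run ((Instr.add c c 1).run ((Instr.const 1 1).run s))

/-- The translation into programs of the machine. -/
def compile : CountProgram → Program
  | instr i => .instr i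
  | seq P Q => .seq P.compile Q.compile
  | branch a P Q => .branch a P.compile Q.compile
  | loop c b P => .seq (.seq (.instr (.const c 0)) (.instr (.sub 1 b c)))
      (.loop 1 (.seq P.compile (.seq (.instr (.const 1 1))
        (.seq (.instr (.add c c 1)) (.instr (.sub 1 b c))))))

/-- The final state. -/
def eval : CountProgram → State → State
  | instr i, s => i.run s
  | seq P Q, s => Q.eval (P.eval s)
  | branch a P Q, s => if s.reg a ≠ 0 then P.eval s else Q.eval s
  | loop c b P, s => (fun s' => loopNext c b (P.eval s'))^[s.reg b] (loopInit c b s)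

/-- A bound for the number of steps, if each loop bound `R_b` is at most `β b`. -/
def cost (β : ℕ → ℕ) : CountProgram → ℕ
  | instr _ => 1
  | seq P Q => P.cost β + Q.cost β
  | branch _ P Q => P.cost β + Q.cost β + 1
  | loop _ b P => β b * (P.cost β + 4) + 3

/-! ### Frame properties and loop invariants of counting programs -/

theorem _root_.RAM.Instr.run_reg_of_notMem {i : Instr} {s : State} {r : ℕ} (h : r ∉ i.writes) :
    (i.run s).reg r = s.reg r := by
  cases i <;> simp_all [Instr.writes, Instr.run, State.setReg, State.setMem]

theorem loopNext_reg {c b r : ℕ} {s : State} (hc : r ≠ c) (h1 : r ≠ 1) :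
    (loopNext c b s).reg r = s.reg r := by
  simp [loopNext, Instr.run, State.setReg, hc, h1]

theorem loopInit_reg {c b r : ℕ} {s : State} (hc : r ≠ c) (h1 : r ≠ 1) :
    (loopInit c b s).reg r = s.reg r := by
  simp [loopInit, Instr.run, State.setReg, hc, h1]

theorem loopNext_mem {c b : ℕ} {s : State} : (loopNext c b s).mem = s.mem := rfl

theorem loopInit_mem {c b : ℕ} {s : State} : (loopInit c b s).mem = s.mem := rfl

theorem loopNext_counter {c b : ℕ} {s : State} (hc : c ≠ 1) :
    (loopNext c b s).reg c = s.reg c + 1 := by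
  simp [loopNext, Instr.run, State.setReg, hc]

theorem loopInit_counter {c b : ℕ} {s : State} (hc : c ≠ 1) : (loopInit c b s).reg c = 0 := by
  simp [loopInit, Instr.run, State.setReg, hc]

/-- Register `1` first supplies the increment and then the test. The test value is the number of
rounds still to come. -/
theorem loopNext_test {c b : ℕ} {s : State} (hc : c ≠ 1) (hb : b ≠ 1) (hcb : c ≠ b) :
    (loopNext c b s).reg 1 = s.reg b - (s.reg c + 1) := by
  simp [loopNext, Instr.run, State.setReg, hc, hb, hcb.symm]

theorem loopInit_test {c b : ℕ} {s : State} (hcb : c ≠ b) :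
    (loopInit c b s).reg 1 = s.reg b := by
  simp [loopInit, Instr.run, State.setReg, hcb.symm]

theorem eval_reg_of_notMem {P : CountProgram} {s : State} {r : ℕ} (h : r ∉ P.writes) :
    (P.eval s).reg r = s.reg r := by
  induction P generalizing s with
  | instr i => exact Instr.run_reg_of_notMem h
  | seq P Q ihP ihQ =>
    simp only [writes, List.mem_append, not_or] at h
    rw [eval, ihQ h.2, ihP h.1]
  | branch a P Q ihP ihQ =>
    simp only [writes, List.mem_append, not_or] at h
    rw [eval]
    split_ifs
    · exact ihP h.1
    · exact ihQ h.2
  | loop c b P ih =>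
    simp only [writes, List.mem_cons, not_or] at h
    rw [eval]
    generalize s.reg b = m
    induction m with
    | zero => exact loopInit_reg h.1 h.2.1
    | succ m ihm =>
      rw [Function.iterate_succ_apply', loopNext_reg h.1 h.2.1, ih h.2.2, ihm]

theorem eval_mem_of_readOnly {P : CountProgram} {s : State} (h : P.readOnly = true) :
    (P.eval s).mem = s.mem := by
  induction P generalizing s with
  | instr i => cases i <;> first | rfl | simp [readOnly] at h
  | seq P Q ihP ihQ =>
    simp only [readOnly, Bool.and_eq_true] at h
    rw [eval, ihQ h.2, ihP h.1]
  | branch a P Q ihP ihQ =>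
    simp only [readOnly, Bool.and_eq_true] at h
    rw [eval]
    split_ifs
    · exact ihP h.1
    · exact ihQ h.2
  | loop c b P ih =>
    rw [eval]
    generalize s.reg b = m
    induction m with
    | zero => rfl
    | succ m ihm => rw [Function.iterate_succ_apply', loopNext_mem, ih h, ihm]

/-- The invariant rule for loops. -/
theorem eval_loop_invariant {c b : ℕ} {P : CountProgram} {s : State}
    (hwf : (loop c b P).wellFormed = true) {m : ℕ} (hm : s.reg b = m) (I : ℕ → State → Prop)
    (hinit : I 0 (loopInit c b s))
    (hstep : ∀ i < m, ∀ s' : State, (∀ r ∉ (loop c b P).writes, s'.reg r = s.reg r) →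
      s'.reg c = i → I i s' → I (i + 1) (loopNext c b (P.eval s'))) :
    I m ((loop c b P).eval s) := by
  subst hm
  simp only [wellFormed, Bool.and_eq_true, bne_iff_ne, Bool.not_eq_true', ne_eq,
    List.contains_eq_mem, decide_eq_false_iff_not] at hwf
  obtain ⟨⟨⟨⟨⟨-, hc1⟩, hb1⟩, hcb⟩, hcP⟩, hbP⟩ := hwf
  -- Frame, counter value and invariant are carried together, so that `hstep` may use the first two.
  have key : ∀ i ≤ s.reg b,
      (∀ r ∉ (loop c b P).writes,
        ((fun s' => loopNext c b (P.eval s'))^[i] (loopInit c b s)).reg r = s.reg r) ∧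
      ((fun s' => loopNext c b (P.eval s'))^[i] (loopInit c b s)).reg c = i ∧
      I i ((fun s' => loopNext c b (P.eval s'))^[i] (loopInit c b s)) := by
    intro i
    induction i with
    | zero =>
      refine fun _ => ⟨fun r hr => ?_, loopInit_counter hc1, hinit⟩
      simp only [writes, List.mem_cons, not_or] at hr
      exact loopInit_reg hr.1 hr.2.1
    | succ i ih =>
      intro hi
      obtain ⟨h1, h2, h3⟩ := ih (by omega)
      rw [Function.iterate_succ_apply']
      refine ⟨fun r hr => ?_, ?_, hstep i (by omega) _ h1 h2 h3⟩
      · rw [← h1 r hr]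
        simp only [writes, List.mem_cons, not_or] at hr
        rw [loopNext_reg hr.1 hr.2.1, eval_reg_of_notMem hr.2.2]
      · rw [loopNext_counter hc1, eval_reg_of_notMem hcP, h2]
  exact (key _ le_rfl).2.2

/-! ### Halting and running time of counting programs -/

/-- A well-formed program that does not change the bounds of its loops halts within the time given
by `cost`. -/
theorem exec_compile {β : ℕ → ℕ} {P : CountProgram} {s : State} (hwf : P.wellFormed = true)
    (hstable : ∀ b ∈ P.bounds, b ∉ P.writes) (hβ : ∀ b ∈ P.bounds, s.reg b ≤ β b) :
    ∃ t ≤ P.cost β, Exec P.compile s t (P.eval s) := by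
  -- With a fixed list `W` containing all written registers, the hypotheses pass to subprograms
  -- unchanged.
  suffices h : ∀ (W : List ℕ) (s : State), (∀ r ∈ P.writes, r ∈ W) → (∀ b ∈ P.bounds, b ∉ W) →
      (∀ b ∈ P.bounds, s.reg b ≤ β b) → ∃ t ≤ P.cost β, Exec P.compile s t (P.eval s) from
    h _ s (fun _ h => h) hstable hβ
  clear hstable hβ s
  intro W
  induction P with
  | instr i => exact fun s _ _ _ => ⟨1, le_rfl, .instr i s⟩
  | seq P Q ihP ihQ =>
    intro s hW hb hs
    simp only [wellFormed, Bool.and_eq_true] at hwf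
    simp only [bounds, writes, List.mem_append] at hW hb hs
    obtain ⟨t, ht, hex⟩ := ihP hwf.1 s (fun r hr => hW r (.inl hr)) (fun r hr => hb r (.inl hr))
      (fun r hr => hs r (.inl hr))
    obtain ⟨t', ht', hex'⟩ := ihQ hwf.2 (P.eval s) (fun r hr => hW r (.inr hr))
      (fun r hr => hb r (.inr hr)) (fun r hr => by
        rw [eval_reg_of_notMem fun h => hb r (.inr hr) (hW r (.inl h))]
        exact hs r (.inr hr))
    exact ⟨t + t', Nat.add_le_add ht ht', .seq hex hex'⟩
  | branch a P Q ihP ihQ =>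
    intro s hW hb hs
    simp only [wellFormed, Bool.and_eq_true] at hwf
    simp only [bounds, writes, List.mem_append] at hW hb hs
    by_cases h : s.reg a = 0
    · obtain ⟨t, ht, hex⟩ := ihQ hwf.2 s (fun r hr => hW r (.inr hr))
        (fun r hr => hb r (.inr hr)) (fun r hr => hs r (.inr hr))
      refine ⟨t + 1, by rw [cost]; omega, ?_⟩
      rw [eval, if_neg (not_not.2 h)]
      exact .branchFalse h hex
    · obtain ⟨t, ht, hex⟩ := ihP hwf.1 s (fun r hr => hW r (.inl hr))
        (fun r hr => hb r (.inl hr)) (fun r hr => hs r (.inl hr))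
      refine ⟨t + 1, by rw [cost]; omega, ?_⟩
      rw [eval, if_pos h]
      exact .branchTrue h hex
  | loop c b P ih =>
    intro s hW hb hs
    simp only [wellFormed, Bool.and_eq_true, bne_iff_ne, Bool.not_eq_true', ne_eq,
      List.contains_eq_mem, decide_eq_false_iff_not] at hwf
    obtain ⟨⟨⟨⟨⟨hwf, hc1⟩, hb1⟩, hcb⟩, hcP⟩, hbP⟩ := hwf
    have hnW : ∀ r ∈ P.bounds, r ∉ P.writes ∧ r ≠ c ∧ r ≠ 1 := fun r hr => by
      have hrW := hb r (List.mem_cons_of_mem _ hr)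
      exact ⟨fun h => hrW (hW _ (List.mem_cons_of_mem _ (List.mem_cons_of_mem _ h))),
        fun h => hrW (hW _ (h ▸ List.mem_cons_self)),
        fun h => hrW (hW _ (h ▸ List.mem_cons_of_mem _ List.mem_cons_self))⟩
    have hbc : b ≠ c := fun h => hcb h.symm
    -- Here `m` is the number of rounds left. A round costs its body, three instructions and one
    -- test; the last test and the two initial instructions give the 3 in `cost`.
    have key : ∀ (m : ℕ) (s' : State), s'.reg 1 = m → s'.reg b = s'.reg c + m →
        (∀ r ∈ P.bounds, s'.reg r ≤ β r) → ∃ t ≤ m * (P.cost β + 4) + 1,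
        Exec (.loop 1 (.seq P.compile (.seq (.instr (.const 1 1))
          (.seq (.instr (.add c c 1)) (.instr (.sub 1 b c)))))) s' t
          ((fun s' => loopNext c b (P.eval s'))^[m] s') := by
      intro m
      induction m with
      | zero => exact fun s' h1 _ _ => ⟨1, by omega, .loopDone h1⟩
      | succ m ihm =>
        intro s' h1 h2 h3
        obtain ⟨t, ht, hex⟩ := ih hwf s'
          (fun r hr => hW r (List.mem_cons_of_mem _ (List.mem_cons_of_mem _ hr)))
          (fun r hr => hb r (List.mem_cons_of_mem _ hr)) h3
        have hb' : (P.eval s').reg b = s'.reg b := eval_reg_of_notMem hbP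
        have hc' : (P.eval s').reg c = s'.reg c := eval_reg_of_notMem hcP
        obtain ⟨t', ht', hex'⟩ := ihm (loopNext c b (P.eval s'))
          (by rw [loopNext_test hc1 hb1 hcb, hb', hc']; omega)
          (by rw [loopNext_reg hbc hb1, loopNext_counter hc1, hb', hc']; omega)
          (fun r hr => by
            obtain ⟨h4, h5, h6⟩ := hnW r hr
            rw [loopNext_reg h5 h6, eval_reg_of_notMem h4]
            exact h3 r hr)
        refine ⟨(t + (1 + (1 + 1))) + t' + 1, ?_, ?_⟩
        · rw [Nat.succ_mul]; omega
        · rw [Function.iterate_succ_apply]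
          exact .loopStep (by omega) (.seq hex (.seq (.instr _ _) (.seq (.instr _ _)
            (.instr _ _)))) hex'
    obtain ⟨t, ht, hex⟩ := key (s.reg b) (loopInit c b s) (loopInit_test hcb)
      (by rw [loopInit_reg hbc hb1, loopInit_counter hc1]; omega)
      (fun r hr => by
        rw [loopInit_reg (hnW r hr).2.1 (hnW r hr).2.2]
        exact hs r (List.mem_cons_of_mem _ hr))
    refine ⟨(1 + 1) + t, ?_, .seq (.seq (.instr _ _) (.instr _ _)) hex⟩
    have := Nat.mul_le_mul_right (P.cost β + 4) (hs b List.mem_cons_self)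
    rw [cost]
    omega

/-- If all loop bounds are at most `n`, the cost is polynomial in `n`. -/
theorem exists_polynomial_cost (P : CountProgram) :
    ∃ p : Polynomial ℕ, ∀ n, P.cost (fun _ => n) = p.eval n := by
  induction P with
  | instr i => exact ⟨1, fun n => by simp [cost]⟩
  | seq P Q ihP ihQ =>
    obtain ⟨p, hp⟩ := ihP
    obtain ⟨q, hq⟩ := ihQ
    exact ⟨p + q, fun n => by simp [cost, hp, hq]⟩
  | branch a P Q ihP ihQ =>
    obtain ⟨p, hp⟩ := ihP
    obtain ⟨q, hq⟩ := ihQ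
    exact ⟨p + q + 1, fun n => by simp [cost, hp, hq]⟩
  | loop c b P ih =>
    obtain ⟨p, hp⟩ := ih
    exact ⟨.X * (p + 4) + 3, fun n => by simp [cost, hp]⟩

theorem cost_congr {P : CountProgram} {β β' : ℕ → ℕ} (h : ∀ b ∈ P.bounds, β b = β' b) :
    P.cost β = P.cost β' := by
  induction P with
  | instr i => rfl
  | seq P Q ihP ihQ =>
    simp only [bounds, List.mem_append] at h
    rw [cost, cost, ihP fun b hb => h b (.inl hb), ihQ fun b hb => h b (.inr hb)]
  | branch a P Q ihP ihQ =>
    simp only [bounds, List.mem_append] at h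
    rw [cost, cost, ihP fun b hb => h b (.inl hb), ihQ fun b hb => h b (.inr hb)]
  | loop c b P ih =>
    simp only [bounds, List.mem_cons] at h
    rw [cost, cost, ih fun b hb => h b (.inr hb), h b (.inl rfl)]

end CountProgram

end RAM

/-! ## The branching algorithm -/

namespace BranchingSearch

/-! ### Choice of the vertex to delete -/

section Target

open Classical

/-- The `d`-th element below `m` of the neighborhood of `v`, and `v` itself if there is no such
element. -/
noncomputable def nthNeighbor (p : ℕ → ℕ → Prop) (d v : ℕ) : ℕ → ℕ
  | 0 => v
  | w + 1 => if p v w ∧ Nat.count (p v) (w + 1) = d then w else nthNeighbor p d v w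

/-- The vertex to be deleted on account of the last vertex below `m` with at least three neighbors,
and `n` if there is no such vertex. -/
noncomputable def degreeTarget (p : ℕ → ℕ → Prop) (n d : ℕ) : ℕ → ℕ
  | 0 => n
  | v + 1 => if 3 ≤ Nat.count (p v) n then nthNeighbor p d v n else degreeTarget p n d v

/-- The number of walks of length `i` from `v` to `u`. -/
noncomputable def walkCount (p : ℕ → ℕ → Prop) (n u : ℕ) : ℕ → ℕ → ℕ
  | 0, v => if v = u then 1 else 0
  | i + 1, v => ∑ w ∈ Finset.range n, if p v w then walkCount p n u i w else 0

/-- There is a closed walk at `u` whose length is odd and at most `m`. -/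
def OddLoop (p : ℕ → ℕ → Prop) (n u m : ℕ) : Prop :=
  ∃ i < m, Odd (i + 1) ∧ walkCount p n u (i + 1) u ≠ 0

/-- The last vertex below `m` on a short odd closed walk, and `n` if there is no such vertex. -/
noncomputable def oddTarget (p : ℕ → ℕ → Prop) (n : ℕ) : ℕ → ℕ
  | 0 => n
  | u + 1 => if OddLoop p n u n then u else oddTarget p n u

/-- The vertex to be deleted next in the branch `d`, and `n` if there is nothing to be done. -/
noncomputable def target (p : ℕ → ℕ → Prop) (n d : ℕ) : ℕ :=
  if degreeTarget p n d n = n then oddTarget p n n else degreeTarget p n d n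

variable {p : ℕ → ℕ → Prop} {n d v u m : ℕ}

/-- The neighbors are numbered from 1, so the digit 0 is free to mean the vertex itself. -/
theorem nthNeighbor_zero : nthNeighbor p 0 v m = v := by
  induction m with
  | zero => rfl
  | succ m ih =>
    rw [nthNeighbor, if_neg, ih]
    rintro ⟨h, hc⟩
    rw [Nat.count_succ, if_pos h] at hc
    omega

theorem nthNeighbor_lt (hv : v < n) (hm : m ≤ n) : nthNeighbor p d v m < n := by
  induction m with
  | zero => exact hv
  | succ m ih =>
    rw [nthNeighbor]
    split_ifs
    · omega
    · exact ih (by omega)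

theorem nthNeighbor_eq {w : ℕ} (hw : w < m) (h : p v w) (hd : Nat.count (p v) (w + 1) = d) :
    nthNeighbor p d v m = w := by
  induction m with
  | zero => omega
  | succ m ih =>
    rw [nthNeighbor]
    split_ifs with hc
    · have h1 := hc.2
      rw [Nat.count_succ, if_pos hc.1] at h1
      rw [Nat.count_succ, if_pos h] at hd
      exact Nat.count_injective hc.1 h (by omega)
    · rcases Nat.lt_succ_iff_lt_or_eq.1 hw with h' | rfl
      · exact ih h'
      · exact absurd ⟨h, hd⟩ hc

/-- A discrete intermediate value argument: the count grows by at most one at a time. -/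
theorem exists_count_eq {q : ℕ → Prop} (hd : 0 < d) (h : d ≤ Nat.count q m) :
    ∃ w < m, q w ∧ Nat.count q (w + 1) = d := by
  induction m with
  | zero => rw [Nat.count_zero] at h; omega
  | succ m ih =>
    by_cases h' : d ≤ Nat.count q m
    · obtain ⟨w, hw, h2⟩ := ih h'
      exact ⟨w, by omega, h2⟩
    · have h1 := h
      rw [Nat.count_succ] at h1
      split_ifs at h1 with hq
      · exact ⟨m, by omega, hq, by rw [Nat.count_succ, if_pos hq]; omega⟩
      · omega

/-- The branches at a vertex with at least three neighbors: three different neighbors. -/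
theorem nthNeighbor_spec (h : d ≤ Nat.count (p v) n) (hd : 0 < d) :
    nthNeighbor p d v n < n ∧ p v (nthNeighbor p d v n) ∧
      Nat.count (p v) (nthNeighbor p d v n + 1) = d := by
  obtain ⟨w, hw, h1, h2⟩ := exists_count_eq hd h
  rw [nthNeighbor_eq hw h1 h2]
  exact ⟨hw, h1, h2⟩

/-- The vertex `v` does not depend on `d`: all branches belong to the same vertex of high degree. -/
theorem degreeTarget_spec (p : ℕ → ℕ → Prop) (n m : ℕ) :
    ((∀ v < m, Nat.count (p v) n < 3) ∧ ∀ d, degreeTarget p n d m = n) ∨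
      ∃ v < m, 3 ≤ Nat.count (p v) n ∧ ∀ d, degreeTarget p n d m = nthNeighbor p d v n := by
  induction m with
  | zero => exact .inl ⟨fun v hv => by omega, fun d => rfl⟩
  | succ m ih =>
    by_cases h : 3 ≤ Nat.count (p m) n
    · exact .inr ⟨m, by omega, h, fun d => by rw [degreeTarget, if_pos h]⟩
    · have hrec : ∀ d, degreeTarget p n d (m + 1) = degreeTarget p n d m := fun d => by
        rw [degreeTarget, if_neg h]
      simp only [hrec]
      rcases ih with ⟨h1, h2⟩ | ⟨v, hv, h1⟩
      · refine .inl ⟨fun v hv => ?_, h2⟩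
        rcases Nat.lt_succ_iff_lt_or_eq.1 hv with h' | rfl
        · exact h1 v h'
        · omega
      · exact .inr ⟨v, by omega, h1⟩

theorem oddTarget_spec (p : ℕ → ℕ → Prop) (n m : ℕ) :
    ((∀ u < m, ¬ OddLoop p n u n) ∧ oddTarget p n m = n) ∨
      (oddTarget p n m < m ∧ OddLoop p n (oddTarget p n m) n) := by
  induction m with
  | zero => exact .inl ⟨fun v hv => by omega, rfl⟩
  | succ m ih =>
    rw [oddTarget]
    split_ifs with h
    · exact .inr ⟨by omega, h⟩
    · rcases ih with ⟨h1, h2⟩ | ⟨h1, h2⟩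
      · refine .inl ⟨fun v hv => ?_, h2⟩
        rcases Nat.lt_succ_iff_lt_or_eq.1 hv with h' | rfl
        · exact h1 v h'
        · exact h
      · exact .inr ⟨by omega, h2⟩

theorem degreeTarget_le : degreeTarget p n d n ≤ n := by
  rcases degreeTarget_spec p n n with ⟨-, h⟩ | ⟨v, hv, -, h⟩
  · exact (h _).le
  · rw [h]
    exact (nthNeighbor_lt hv le_rfl).le

theorem target_le (p : ℕ → ℕ → Prop) (n d : ℕ) : target p n d ≤ n := by
  rw [target]
  split_ifs
  · rcases oddTarget_spec p n n with ⟨-, h⟩ | ⟨h, -⟩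
    · exact h.le
    · exact h.le
  · exact degreeTarget_le

theorem three_le_count {q : ℕ → Prop} {a b c : ℕ} (ha : a < n) (hb : b < n) (hc : c < n)
    (qa : q a) (qb : q b) (qc : q c) (hab : a ≠ b) (hac : a ≠ c) (hbc : b ≠ c) :
    3 ≤ Nat.count q n := by
  rw [Nat.count_eq_card_filter_range]
  calc 3 = ({a, b, c} : Finset ℕ).card := by
        rw [Finset.card_eq_three.2 ⟨a, b, c, hab, hac, hbc, rfl⟩]
    _ ≤ _ := Finset.card_le_card fun x hx => by
        simp only [Finset.mem_insert, Finset.mem_singleton] at hx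
        rcases hx with rfl | rfl | rfl <;> simp [*]

end Target

/-! ### Correctness of the search on graphs -/

section Graph

variable {n : ℕ} (G : SimpleGraph (Fin n))

/-- The graph that remains after the deletion of the vertices in `D`. -/
def residual (D : Finset ℕ) : SimpleGraph (Fin n) := G.isolate {v | (v : ℕ) ∈ D}

/-- Adjacency in the remaining graph, for vertices given as numbers. -/
def residualAdj (D : Finset ℕ) (v w : ℕ) : Prop :=
  ∃ (hv : v < n) (hw : w < n), (residual G D).Adj ⟨v, hv⟩ ⟨w, hw⟩

variable {G} {D : Finset ℕ}

theorem residualAdj_val {v w : Fin n} : residualAdj G D v w ↔ (residual G D).Adj v w := by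
  simp [residualAdj]

theorem walkCount_ne_zero_iff {u v : Fin n} {i : ℕ} :
    walkCount (residualAdj G D) n u i v ≠ 0 ↔ ∃ w : (residual G D).Walk v u, w.length = i := by
  induction i generalizing v with
  | zero =>
    simp only [walkCount, ne_eq, ite_eq_right_iff, one_ne_zero, imp_false, not_not, Fin.val_inj]
    constructor
    · rintro rfl
      exact ⟨.nil, rfl⟩
    · rintro ⟨w, hw⟩
      exact w.eq_of_length_eq_zero hw
  | succ i ih =>
    simp only [walkCount, ne_eq, Finset.sum_eq_zero_iff, Finset.mem_range, ite_eq_right_iff,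
      not_forall]
    constructor
    · rintro ⟨x, hx, hadj, h⟩
      obtain ⟨w, hw⟩ := (ih (v := ⟨x, hx⟩)).1 h
      exact ⟨.cons (residualAdj_val.1 hadj) w, by simp [hw]⟩
    · rintro ⟨w, hw⟩
      cases w with
      | nil => simp at hw
      | @cons _ x _ h w =>
        refine ⟨x, x.2, residualAdj_val.2 h, ih.2 ⟨w, ?_⟩⟩
        simpa using hw

theorem degreeLeTwo_iff : (residual G D).DegreeLeTwo ↔
    ∀ d, degreeTarget (residualAdj G D) n d n = n := by
  classical
  rcases degreeTarget_spec (residualAdj G D) n n with ⟨h1, h2⟩ | ⟨v, hv, h1, h2⟩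
  · refine iff_of_true (fun v a b c ha hb hc hab hac hbc => ?_) h2
    have h3 := three_le_count (q := residualAdj G D v) a.2 b.2 c.2 (residualAdj_val.2 ha)
      (residualAdj_val.2 hb) (residualAdj_val.2 hc) (by simpa [Fin.val_inj] using hab)
      (by simpa [Fin.val_inj] using hac) (by simpa [Fin.val_inj] using hbc)
    have h4 := h1 v v.2
    simp only [Nat.count_eq_card_filter_range] at h3 h4
    omega
  · refine iff_of_false (fun hd => ?_) fun h => ?_
    · obtain ⟨l1, ⟨_, _, a1⟩, c1⟩ := nthNeighbor_spec (le_trans (by norm_num) h1) one_pos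
      obtain ⟨l2, ⟨_, _, a2⟩, c2⟩ := nthNeighbor_spec (le_trans (by norm_num) h1) two_pos
      obtain ⟨l3, ⟨_, _, a3⟩, c3⟩ := nthNeighbor_spec h1 three_pos
      refine hd _ _ _ _ a1 a2 a3 ?_ ?_ ?_ <;> intro h <;> rw [Fin.mk.injEq] at h
      · rw [h, c2] at c1; omega
      · rw [h, c3] at c1; omega
      · rw [h, c3] at c2; omega
    · have := nthNeighbor_lt (p := residualAdj G D) (d := 0) hv le_rfl
      rw [← h2, h] at this
      omega

/-- Testing lengths up to `n` suffices: an odd closed walk yields an odd cycle, and a cycle has at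
most `n` vertices. -/
theorem loopsEven_iff : (residual G D).LoopsEven ↔ oddTarget (residualAdj G D) n n = n := by
  rcases oddTarget_spec (residualAdj G D) n n with ⟨h1, h2⟩ | ⟨h1, i, -, hi, h2⟩
  · refine iff_of_true (fun u w => ?_) h2
    by_contra hw
    obtain ⟨v, c, hc, hodd⟩ := w.exists_odd_cycle (Nat.not_even_iff_odd.1 hw)
    have hlen : c.length ≤ n := by
      have := hc.support_nodup.length_le_card
      simpa using this
    have hpos := hodd.pos
    refine h1 v v.2 ⟨c.length - 1, by omega, ?_, ?_⟩ <;>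
      rw [show c.length - 1 + 1 = c.length by omega]
    · exact hodd
    · exact walkCount_ne_zero_iff.2 ⟨c, rfl⟩
  · refine iff_of_false (fun h => ?_) h1.ne
    obtain ⟨w, hw⟩ := (walkCount_ne_zero_iff (u := ⟨_, h1⟩) (v := ⟨_, h1⟩)).1 h2
    exact (Nat.not_even_iff_odd.2 hi) (hw ▸ h _ w)

/-- The search stops exactly at the 2-edge-colorable graphs. -/
theorem target_eq_iff (d : ℕ) :
    target (residualAdj G D) n d = n ↔ (residual G D).EdgeColorable 2 := by
  rw [SimpleGraph.edgeColorable_two_iff, degreeLeTwo_iff, loopsEven_iff, target]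
  rcases degreeTarget_spec (residualAdj G D) n n with ⟨h1, h2⟩ | ⟨v, hv, h1, h2⟩
  · simp [h2]
  · have hlt : ∀ d, nthNeighbor (residualAdj G D) d v n ≠ n := fun d =>
      (nthNeighbor_lt hv le_rfl).ne
    simp [h2, hlt]

theorem residual_union_eq {D X : Finset ℕ} :
    residual G (D ∪ X) = G.isolate ({v | (v : ℕ) ∈ D} ∪ {v | (v : ℕ) ∈ X}) := by
  rw [residual]
  congr 1
  ext v
  simp

/-- If the remaining graph has a solution, one of the branches leads to a graph that has a smaller
solution. -/
theorem exists_branch {X : Finset ℕ} (hD : ¬ (residual G D).EdgeColorable 2)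
    (hX : (residual G (D ∪ X)).EdgeColorable 2) :
    ∃ d < 4, ∃ x ∈ X,
      (residual G (insert (target (residualAdj G D) n d) D ∪ X.erase x)).EdgeColorable 2 := by
  classical
  rcases degreeTarget_spec (residualAdj G D) n n with ⟨h1, h2⟩ | ⟨v, hv, h1, h2⟩
  · have hdeg : (residual G D).DegreeLeTwo := degreeLeTwo_iff.2 h2
    have htar : ∀ d, target (residualAdj G D) n d = oddTarget (residualAdj G D) n n := fun d => by
      rw [target, if_pos (h2 d)]
    rw [← target_eq_iff 0, htar] at hD
    rcases oddTarget_spec (residualAdj G D) n n with ⟨-, h⟩ | ⟨h3, i, -, hi, h4⟩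
    · exact absurd h hD
    -- Any digit would do, since the odd target ignores it.
    refine ⟨0, by omega, ?_⟩
    rw [htar]
    set u := oddTarget (residualAdj G D) n n
    obtain ⟨w, hw⟩ := (walkCount_ne_zero_iff (u := ⟨_, h3⟩) (v := ⟨_, h3⟩)).1 h4
    rw [residual_union_eq] at hX
    obtain ⟨x, hxX, hx⟩ := SimpleGraph.exists_exchange hdeg w (hw ▸ hi) hX
    refine ⟨x, hxX, ?_⟩
    rw [residual_union_eq]
    convert hx using 3
    · ext y
      simp [Fin.ext_iff]
    · ext y
      simp [Fin.ext_iff, and_comm]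
  · have hlt : ∀ d, nthNeighbor (residualAdj G D) d v n < n := fun d => nthNeighbor_lt hv le_rfl
    have htar : ∀ d, target (residualAdj G D) n d = nthNeighbor (residualAdj G D) d v n :=
      fun d => by rw [target, h2, if_neg (hlt d).ne]
    -- Moving a target that lies in `X` from `X` to `D` leaves the union unchanged. If no target lay
    -- in `X`, then `v` would survive together with three neighbors.
    suffices h : ∃ d < 4, nthNeighbor (residualAdj G D) d v n ∈ X by
      obtain ⟨d, hd, hx⟩ := h
      refine ⟨d, hd, _, hx, ?_⟩
      rw [htar]
      convert hX using 2
      ext y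
      simp only [Finset.mem_union, Finset.mem_insert, Finset.mem_erase]
      by_cases hy : y = nthNeighbor (residualAdj G D) d v n
      · simp [hy, hx]
      · simp [hy]
    by_contra hno
    push Not at hno
    have h0 := hno 0 (by omega)
    rw [nthNeighbor_zero] at h0
    obtain ⟨l1, ⟨_, _, a1⟩, c1⟩ := nthNeighbor_spec (le_trans (by norm_num) h1) one_pos
    obtain ⟨l2, ⟨_, _, a2⟩, c2⟩ := nthNeighbor_spec (le_trans (by norm_num) h1) two_pos
    obtain ⟨l3, ⟨_, _, a3⟩, c3⟩ := nthNeighbor_spec h1 three_pos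
    have key : ∀ w (hw : w < n), w ∉ X → (residual G D).Adj ⟨v, hv⟩ ⟨w, hw⟩ →
        (residual G (D ∪ X)).Adj ⟨v, hv⟩ ⟨w, hw⟩ := by
      intro w hw hwX h
      rw [residual_union_eq]
      exact ⟨h.1, fun h' => h'.elim h.2.1 h0, fun h' => h'.elim h.2.2 hwX⟩
    refine hX.degreeLeTwo _ _ _ _ (key _ _ (hno 1 (by omega)) a1) (key _ _ (hno 2 (by omega)) a2)
      (key _ _ (hno 3 (by omega)) a3) ?_ ?_ ?_ <;> intro h <;> rw [Fin.mk.injEq] at h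
    · rw [h, c2] at c1; omega
    · rw [h, c3] at c1; omega
    · rw [h, c3] at c2; omega

variable (G) in
/-- One round of the search. A state consists of the remaining guesses (the digits of a number in
base four), the vertices deleted so far, and the vertex deleted last. -/
noncomputable def searchStep (x : ℕ × Finset ℕ × ℕ) : ℕ × Finset ℕ × ℕ :=
  (x.1 / 4, insert (target (residualAdj G x.2.1) n (x.1 % 4)) x.2.1,
    target (residualAdj G x.2.1) n (x.1 % 4))

/-- The value `n` is not a vertex. Once the graph is colorable, the remaining rounds delete only
this dummy. -/
theorem residual_insert_self : residual G (insert n D) = residual G D := by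
  rw [residual, residual]
  congr 1
  ext v
  simp [v.2.ne]

theorem search_of_edgeColorable {r q t : ℕ} (hD : (residual G D).EdgeColorable 2) :
    ((searchStep G)^[r + 1] (q, D, t)).2.2 = n := by
  induction r generalizing D q t with
  | zero => exact (target_eq_iff _).2 hD
  | succ r ih =>
    rw [Function.iterate_succ_apply, searchStep]
    dsimp only
    rw [(target_eq_iff _).2 hD]
    exact ih (by rwa [residual_insert_self])

/-- The set `X` collects the targets of the first `r` rounds; the last round only tests. It may
contain the dummy `n`. -/
theorem search_sound {r q t : ℕ} (h : ((searchStep G)^[r + 1] (q, D, t)).2.2 = n) :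
    ∃ X : Finset ℕ, X.card ≤ r ∧ (residual G (D ∪ X)).EdgeColorable 2 := by
  induction r generalizing D q t with
  | zero => exact ⟨∅, le_rfl, by simpa using (target_eq_iff _).1 h⟩
  | succ r ih =>
    rw [Function.iterate_succ_apply] at h
    obtain ⟨X, hX, hc⟩ := ih h
    refine ⟨insert (target (residualAdj G D) n (q % 4)) X, (Finset.card_insert_le _ _).trans
      (by omega), ?_⟩
    convert hc using 2
    simp

/-- Each round uses up one element of the solution, and its correct guess becomes the lowest digit
of `q`. -/
theorem search_complete {r t : ℕ} {X : Finset ℕ} (hX : X.card ≤ r)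
    (h : (residual G (D ∪ X)).EdgeColorable 2) :
    ∃ q < 4 ^ (r + 1), ((searchStep G)^[r + 1] (q, D, t)).2.2 = n := by
  induction r generalizing D X t with
  | zero =>
    rw [Finset.card_eq_zero.1 (Nat.le_zero.1 hX)] at h
    exact ⟨0, by simp, search_of_edgeColorable (by simpa using h)⟩
  | succ r ih =>
    by_cases hD : (residual G D).EdgeColorable 2
    · exact ⟨0, by positivity, search_of_edgeColorable hD⟩
    obtain ⟨d, hd, x, hx, hc⟩ := exists_branch hD h
    obtain ⟨q, hq, hs⟩ := ih (t := target (residualAdj G D) n d)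
      (by rw [Finset.card_erase_of_mem hx]; omega) hc
    refine ⟨4 * q + d, by rw [pow_succ]; omega, ?_⟩
    rw [Function.iterate_succ_apply, searchStep]
    dsimp only
    rwa [show (4 * q + d) % 4 = d by omega, show (4 * q + d) / 4 = q by omega]

end Graph

theorem yes_iff_search (x : GraphBudget) :
    x.Yes ↔ ∃ q < 4 ^ (x.k + 1), ((searchStep x.G)^[x.k + 1] (q, ∅, 0)).2.2 = x.n := by
  constructor
  · rintro ⟨X, hX, hc⟩
    refine search_complete (X := X.map Fin.valEmbedding) (by simpa using hX) ?_
    have := (SimpleGraph.edgeColorable_induce_iff (D := {v | v ∈ X})).1 hc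
    simpa [residual, Fin.val_inj] using this
  · rintro ⟨q, -, h⟩
    obtain ⟨X, hX, hc⟩ := search_sound h
    -- Numbers in `X` that are not vertices are dropped.
    refine ⟨Finset.univ.filter fun v : Fin x.n => (v : ℕ) ∈ X, ?_, ?_⟩
    · refine (Finset.card_le_card_of_injOn Fin.val (fun v hv => ?_)
        Fin.val_injective.injOn).trans hX
      simpa using hv
    · rw [residual, Finset.empty_union] at hc
      convert SimpleGraph.edgeColorable_induce_iff.2 hc using 3 <;> simp

end BranchingSearch

/-! ## The program -/

namespace RAM

@[simp] theorem State.setReg_reg (s : State) (d v r : ℕ) :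
    (s.setReg d v).reg r = if r = d then v else s.reg r := by
  simp [State.setReg, Function.update_apply]

@[simp] theorem State.setReg_mem (s : State) (d v : ℕ) : (s.setReg d v).mem = s.mem := rfl

@[simp] theorem State.setMem_mem (s : State) (a v x : ℕ) :
    (s.setMem a v).mem x = if x = a then v else s.mem x := by
  simp [State.setMem, Function.update_apply]

@[simp] theorem State.setMem_reg (s : State) (a v : ℕ) : (s.setMem a v).reg = s.reg := rfl

namespace CountProgram

/-- A sequence of instructions. -/
def block : List Instr → CountProgram
  | [] => instr (.copy 1 1)
  | i :: l => seq (instr i) (block l)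

theorem eval_block (l : List Instr) (s : State) :
    (block l).eval s = l.foldl (fun s i => i.run s) s := by
  induction l generalizing s with
  | nil => simp [block, eval, Instr.run, State.setReg]
  | cons i l ih => rw [block, eval, ih]; rfl

theorem eval_seq (P Q : CountProgram) (s : State) : (seq P Q).eval s = Q.eval (P.eval s) := rfl

theorem eval_branch (a : ℕ) (P Q : CountProgram) (s : State) :
    (branch a P Q).eval s = if s.reg a ≠ 0 then P.eval s else Q.eval s := rfl

end CountProgram

end RAM

namespace BranchingSearch

open RAM RAM.CountProgram

/-- The state of the machine represents a graph with the vertices `0, …, n - 1` and the adjacency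
relation `p`.

Registers: `0` answer, `1` loop tests, `2` the number `n` of vertices, `3` the number of rounds,
`4` the number of branches, `5` and `6` the addresses of the table of the remaining vertices and of
the table of walks, `8` the branch, `9` its unused digits, `11` its current digit, `13` the vertex
to be deleted. -/
structure Ctx (p : ℕ → ℕ → Prop) (n : ℕ) (s : State) : Prop where
  size : s.reg 2 = n
  alive : s.reg 5 = 2 + n * n
  table : s.reg 6 = 2 + n * n + n
  adj : ∀ v < n, ∀ w < n, (s.mem (2 + v * n + w) ≠ 0 ∧ s.mem (2 + n * n + v) ≠ 0 ∧
    s.mem (2 + n * n + w) ≠ 0) ↔ p v w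

theorem Ctx.of_eq {p : ℕ → ℕ → Prop} {n : ℕ} {s s' : State} (h : Ctx p n s)
    (h2 : s'.reg 2 = s.reg 2) (h5 : s'.reg 5 = s.reg 5) (h6 : s'.reg 6 = s.reg 6)
    (hm : ∀ a < 2 + n * n + n, s'.mem a = s.mem a) : Ctx p n s' := by
  refine ⟨h2.trans h.size, h5.trans h.alive, h6.trans h.table, fun v hv w hw => ?_⟩
  have : v * n + n ≤ n * n := by nlinarith
  rw [hm _ (by omega), hm _ (by omega), hm _ (by omega)]
  exact h.adj v hv w hw

/-- Test whether the vertices in the registers `14` and `15` are adjacent in the remaining graph. -/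
def adjProg : CountProgram :=
  .seq (block [.const 20 2])
  (.seq (.loop 21 2 (block [.add 20 20 14]))
  (.seq (block [.add 20 20 15, .load 18 20])
  (.branch 18 (.seq (block [.add 20 5 14, .load 18 20])
    (.branch 18 (block [.add 20 5 15, .load 18 20]) (block []))) (block []))))

/-- Count the neighbors of the vertex in register `14` and find the one with the number in
register `11`. -/
def degreeProg : CountProgram :=
  .seq (block [.const 16 0, .copy 17 14])
  (.loop 15 2 (.seq adjProg
    (.branch 18 (.seq (block [.const 19 1, .add 16 16 19, .sub 19 16 11, .sub 20 11 16,
      .add 19 19 20]) (.branch 19 (block []) (block [.copy 17 15]))) (block []))))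

/-- Write `degreeTarget` to register `13`. -/
def degreeTargetProg : CountProgram :=
  .seq (block [.copy 13 2])
  (.loop 14 2 (.seq degreeProg (.seq (block [.const 19 2, .sub 19 16 19])
    (.branch 19 (block [.copy 13 17]) (block [])))))

/-- The first row of the table of walks to the vertex in register `22`. -/
def walkInitProg : CountProgram :=
  .seq (.loop 14 2 (block [.add 20 6 14, .const 19 0, .store 20 19]))
  (block [.add 20 6 22, .const 19 1, .store 20 19, .copy 24 6, .const 26 0])

/-- One entry of the next row of the table of walks. -/
def walkEntryProg : CountProgram :=
  .seq (block [.const 27 0])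
  (.seq (.loop 15 2 (.seq adjProg
    (.branch 18 (block [.add 20 24 15, .load 19 20, .add 27 27 19]) (block []))))
  (block [.add 20 25 14, .store 20 27]))

/-- The next row of the table of walks. -/
def walkRowProg : CountProgram :=
  .seq (block [.add 25 24 2])
  (.seq (.loop 14 2 walkEntryProg) (block [.copy 24 25, .const 19 1, .sub 26 19 26]))

/-- Write the vertex in register `22` to register `13` if it lies on a short odd closed walk. -/
def oddLoopProg : CountProgram :=
  .seq walkInitProg
  (.loop 23 2 (.seq walkRowProg
    (.branch 26 (.seq (block [.add 20 24 22, .load 19 20])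
      (.branch 19 (block [.copy 13 22]) (block []))) (block []))))

/-- Write `target` to register `13`. -/
def targetProg : CountProgram :=
  .seq degreeTargetProg (.seq (block [.sub 19 2 13])
    (.branch 19 (block []) (.loop 22 2 oddLoopProg)))

/-- Split off the last digit in base four from register `9`. -/
def digitProg : CountProgram :=
  .seq (block [.const 11 0, .const 12 0])
  (.seq (.loop 29 4 (.seq (block [.sub 19 9 29])
    (.branch 19 (.seq (block [.const 19 1, .add 11 11 19, .const 19 3, .sub 19 11 19])
      (.branch 19 (block [.const 11 0, .const 19 1, .add 12 12 19]) (block []))) (block []))))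
  (block [.copy 9 12]))

/-- One round of the search. -/
def roundProg : CountProgram :=
  .seq digitProg (.seq targetProg (block [.add 20 5 13, .const 19 0, .store 20 19]))

/-- Follow the branch given by register `8`; set the answer to `1` if a solution is found. -/
def branchProg : CountProgram :=
  .seq (.loop 14 2 (block [.const 19 1, .add 20 5 14, .store 20 19]))
  (.seq (block [.copy 9 8])
  (.seq (.loop 10 3 roundProg)
  (.seq (block [.sub 19 2 13]) (.branch 19 (block []) (block [.const 0 1])))))

/-- Try all branches. -/
def mainProg : CountProgram := .loop 8 4 branchProg

/-- Read the input. -/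
def readProg : CountProgram :=
  block [.const 0 0, .const 20 0, .load 2 20, .const 20 1, .load 3 20, .add 3 3 20,
    .const 4 1, .const 5 2]

/-- Compute the number of branches and the addresses of the tables. -/
def setupProg : CountProgram :=
  .seq (.loop 10 3 (block [.add 4 4 4, .add 4 4 4]))
  (.seq (.loop 14 2 (block [.add 5 5 2])) (block [.add 6 5 2]))

def initProg : CountProgram := .seq readProg setupProg

/-! ### Correctness of the adjacency and degree subroutines -/

section

variable {p : ℕ → ℕ → Prop} {n : ℕ} {s : State}

theorem adjProg_mem : (adjProg.eval s).mem = s.mem := eval_mem_of_readOnly (by decide)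

theorem Ctx.adjProg_spec (h : Ctx p n s) {v w : ℕ} (hv : v < n) (hw : w < n) (h14 : s.reg 14 = v)
    (h15 : s.reg 15 = w) : (adjProg.eval s).reg 18 ≠ 0 ↔ p v w := by
  -- The row offset is a product, computed by repeated addition.
  have hloop : ∀ s : State, ((loop 21 2 (block [.add 20 20 14])).eval s).reg 20 =
      s.reg 20 + s.reg 2 * s.reg 14 := fun s =>
    eval_loop_invariant (by decide) rfl (fun i s' => s'.reg 20 = s.reg 20 + i * s.reg 14)
      (by simp [loopInit_reg]) fun i _ s' hf hc hI => by
        rw [loopNext_reg (by decide) (by decide)]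
        simp [eval_block, Instr.run, hI, hf 14 (by decide)]
        ring
  rw [← h.adj v hv w hw, adjProg]
  simp only [eval_seq, eval_branch, eval_block, List.foldl, Instr.run]
  simp (disch := decide) [eval_reg_of_notMem, eval_mem_of_readOnly, hloop, h14, h15, h.size,
    h.alive, mul_comm n v]
  split_ifs <;> simp_all

open Classical in
-- Equality of the count and the digit is tested by adding the two truncated differences: the sum
-- vanishes iff they agree.
theorem Ctx.degreeProg_spec (h : Ctx p n s) {v : ℕ} (hv : v < n) (h14 : s.reg 14 = v) :
    (degreeProg.eval s).reg 16 = Nat.count (p v) n ∧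
      (degreeProg.eval s).reg 17 = nthNeighbor p (s.reg 11) v n := by
  rw [degreeProg, eval_seq]
  set s₀ := (block [.const 16 0, .copy 17 14]).eval s with hs₀
  have hr : ∀ r, r ≠ 16 → r ≠ 17 → s₀.reg r = s.reg r := fun r h1 h2 => by
    simp [hs₀, eval_block, Instr.run, h1, h2]
  refine (eval_loop_invariant (m := n) (by decide) (by rw [hr _ (by decide) (by decide), h.size])
    (fun i s' => s'.mem = s.mem ∧ s'.reg 16 = Nat.count (p v) i ∧
      s'.reg 17 = nthNeighbor p (s.reg 11) v i) ?_ ?_).2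
  · simp [loopInit_reg, loopInit_mem, hs₀, eval_block, Instr.run, h14, nthNeighbor]
  · rintro i hi s' hf hc ⟨hI, h16, h17⟩
    have hctx : Ctx p n s' := h.of_eq (by rw [hf _ (by decide), hr _ (by decide) (by decide)])
      (by rw [hf _ (by decide), hr _ (by decide) (by decide)])
      (by rw [hf _ (by decide), hr _ (by decide) (by decide)]) (fun a _ => by rw [hI])
    have h14' : s'.reg 14 = v := by rw [hf _ (by decide), hr _ (by decide) (by decide), h14]
    have h11' : s'.reg 11 = s.reg 11 := by rw [hf _ (by decide), hr _ (by decide) (by decide)]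
    have hadj := hctx.adjProg_spec hv hi h14' hc
    rw [loopNext_reg (by decide) (by decide), loopNext_reg (by decide) (by decide), loopNext_mem]
    refine ⟨by rw [eval_mem_of_readOnly (by decide), hI], ?_⟩
    simp only [eval_seq, eval_branch, eval_block, List.foldl, Instr.run, nthNeighbor,
      Nat.count_succ]
    by_cases hp : p v i
    · rw [if_pos (hadj.2 hp), if_pos hp]
      simp (disch := decide) [eval_reg_of_notMem, h16, h11', hc, hp]
      constructor
      · split_ifs <;> simp
      · split_ifs <;> simp (disch := decide) [eval_reg_of_notMem, h17] <;> omega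
    · rw [if_neg (mt hadj.1 hp), if_neg hp]
      simp (disch := decide) [eval_reg_of_notMem, h16, h17, hp]

theorem degreeTargetProg_mem : (degreeTargetProg.eval s).mem = s.mem :=
  eval_mem_of_readOnly (by decide)

theorem Ctx.degreeTargetProg_spec (h : Ctx p n s) :
    (degreeTargetProg.eval s).reg 13 = degreeTarget p n (s.reg 11) n := by
  classical
  rw [degreeTargetProg, eval_seq]
  set s₀ := (block [.copy 13 2]).eval s with hs₀
  have hr : ∀ r, r ≠ 13 → s₀.reg r = s.reg r := fun r h1 => by
    simp [hs₀, eval_block, Instr.run, h1]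
  refine (eval_loop_invariant (m := n) (by decide) (by rw [hr _ (by decide), h.size])
    (fun i s' => s'.mem = s.mem ∧ s'.reg 13 = degreeTarget p n (s.reg 11) i) ?_ ?_).2
  · simp [loopInit_reg, loopInit_mem, hs₀, eval_block, Instr.run, degreeTarget, h.size]
  · rintro i hi s' hf hc ⟨hI, h13⟩
    have hctx : Ctx p n s' := h.of_eq (by rw [hf _ (by decide), hr _ (by decide)])
      (by rw [hf _ (by decide), hr _ (by decide)])
      (by rw [hf _ (by decide), hr _ (by decide)]) (fun a _ => by rw [hI])
    have h11' : s'.reg 11 = s.reg 11 := by rw [hf _ (by decide), hr _ (by decide)]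
    obtain ⟨hd1, hd2⟩ := hctx.degreeProg_spec hi hc
    rw [loopNext_reg (by decide) (by decide), loopNext_mem]
    refine ⟨by rw [eval_mem_of_readOnly (by decide), hI], ?_⟩
    simp only [eval_seq, eval_branch, eval_block, List.foldl, Instr.run, degreeTarget]
    simp [hd1, hd2, h11']
    split_ifs <;> first | omega | simp (disch := decide) [eval_reg_of_notMem, h13]

end

/-! ### Correctness of the walk table, the target and the digits -/

section

variable {p : ℕ → ℕ → Prop} {n : ℕ} {s : State}

theorem Ctx.walkInitProg_spec (h : Ctx p n s) {u : ℕ} (h22 : s.reg 22 = u) :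
    (walkInitProg.eval s).reg 24 = 2 + n * n + n ∧ (walkInitProg.eval s).reg 26 = 0 ∧
      (∀ v < n, (walkInitProg.eval s).mem (2 + n * n + n + v) = walkCount p n u 0 v) ∧
      ∀ a < 2 + n * n + n, (walkInitProg.eval s).mem a = s.mem a := by
  have hloop := eval_loop_invariant (c := 14) (b := 2)
    (P := block [.add 20 6 14, .const 19 0, .store 20 19]) (s := s) (by decide) h.size
    (fun i s' => (∀ v < i, s'.mem (2 + n * n + n + v) = 0) ∧
      ∀ a < 2 + n * n + n, s'.mem a = s.mem a) ⟨fun v hv => by omega, fun a _ => rfl⟩ (by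
    rintro i hi s' hf hc ⟨h1, h2⟩
    rw [loopNext_mem]
    simp [eval_block, Instr.run, hc, hf 6 (by decide), h.table]
    refine ⟨fun v hv hne => h1 v (by omega), fun a ha => ?_⟩
    rw [if_neg (by omega), h2 a ha])
  rw [walkInitProg, eval_seq]
  have h6 := eval_reg_of_notMem (s := s) (r := 6)
    (P := loop 14 2 (block [.add 20 6 14, .const 19 0, .store 20 19])) (by decide)
  have h22' := eval_reg_of_notMem (s := s) (r := 22)
    (P := loop 14 2 (block [.add 20 6 14, .const 19 0, .store 20 19])) (by decide)
  revert hloop h6 h22'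
  generalize (loop 14 2 (block [.add 20 6 14, .const 19 0, .store 20 19])).eval s = s₁
  rintro ⟨h1, h2⟩ h6 h22'
  simp [eval_block, Instr.run, h6, h22', h22, h.table, walkCount]
  refine ⟨fun v hv => ?_, fun a ha => ?_⟩
  · split_ifs
    · rfl
    · exact h1 v hv
  · rw [if_neg (by omega), h2 a ha]

open Classical in
theorem Ctx.walkEntryProg_spec (h : Ctx p n s) {v src : ℕ} {f : ℕ → ℕ} (hv : v < n)
    (h14 : s.reg 14 = v) (h24 : s.reg 24 = src) (hsrc : ∀ w < n, s.mem (src + w) = f w) (a : ℕ) :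
    (walkEntryProg.eval s).mem a =
      if a = s.reg 25 + v then ∑ w ∈ Finset.range n, if p v w then f w else 0 else s.mem a := by
  rw [walkEntryProg, eval_seq, eval_seq]
  set s₀ := (block [.const 27 0]).eval s with hs₀
  have hr : ∀ r, r ≠ 27 → s₀.reg r = s.reg r := fun r h1 => by
    simp [hs₀, eval_block, Instr.run, h1]
  have hloop := eval_loop_invariant (c := 15) (b := 2) (m := n) (s := s₀)
    (P := .seq adjProg
      (.branch 18 (block [.add 20 24 15, .load 19 20, .add 27 27 19]) (block [])))
    (by decide) (by rw [hr _ (by decide), h.size])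
    (fun i s' => s'.mem = s.mem ∧
      s'.reg 27 = ∑ w ∈ Finset.range i, if p v w then f w else 0)
    (by simp [loopInit_reg, loopInit_mem, hs₀, eval_block, Instr.run]) (by
    rintro i hi s' hf hc ⟨hI, h27⟩
    have hctx : Ctx p n s' := h.of_eq (by rw [hf _ (by decide), hr _ (by decide)])
      (by rw [hf _ (by decide), hr _ (by decide)])
      (by rw [hf _ (by decide), hr _ (by decide)]) (fun a _ => by rw [hI])
    have h14' : s'.reg 14 = v := by rw [hf _ (by decide), hr _ (by decide), h14]
    have h24' : s'.reg 24 = src := by rw [hf _ (by decide), hr _ (by decide), h24]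
    have hadj := hctx.adjProg_spec hv hi h14' hc
    rw [loopNext_reg (by decide) (by decide), loopNext_mem]
    refine ⟨by rw [eval_mem_of_readOnly (by decide), hI], ?_⟩
    simp only [eval_seq, eval_branch, eval_block, List.foldl, Instr.run, Finset.sum_range_succ]
    by_cases hp : p v i
    · rw [if_pos (hadj.2 hp), if_pos hp]
      simp (disch := decide) [eval_reg_of_notMem, adjProg_mem, h27, h24', hc, hI, hsrc i hi]
    · rw [if_neg (mt hadj.1 hp), if_neg hp]
      simp (disch := decide) [eval_reg_of_notMem, h27])
  have hfr : ∀ r ∉ (loop 15 2 (.seq adjProg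
      (.branch 18 (block [.add 20 24 15, .load 19 20, .add 27 27 19]) (block [])))).writes, _ :=
    fun r hr => eval_reg_of_notMem (s := s₀) hr
  revert hloop hfr
  generalize CountProgram.eval (loop 15 2 _) s₀ = s₁
  rintro ⟨h1, h2⟩ hfr
  have h25 : s₁.reg 25 = s.reg 25 := by rw [hfr _ (by decide), hr _ (by decide)]
  have h14' : s₁.reg 14 = v := by rw [hfr _ (by decide), hr _ (by decide), h14]
  simp [eval_block, Instr.run, h25, h14', h2, h1]

open Classical in
-- The new row starts where the old one ends. With `hle`, filling it spoils neither the old row nor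
-- the cells that `Ctx` speaks of.
theorem Ctx.walkRowProg_spec (h : Ctx p n s) {src : ℕ} {f : ℕ → ℕ}
    (h24 : s.reg 24 = src) (hle : 2 + n * n + n ≤ src) (hsrc : ∀ w < n, s.mem (src + w) = f w) :
    (walkRowProg.eval s).reg 24 = src + n ∧ (walkRowProg.eval s).reg 26 = 1 - s.reg 26 ∧
      (∀ v < n, (walkRowProg.eval s).mem (src + n + v) =
        ∑ w ∈ Finset.range n, if p v w then f w else 0) ∧
      ∀ a < src + n, (walkRowProg.eval s).mem a = s.mem a := by
  rw [walkRowProg, eval_seq, eval_seq]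
  set s₀ := (block [.add 25 24 2]).eval s with hs₀
  have hr : ∀ r, r ≠ 25 → s₀.reg r = s.reg r := fun r h1 => by
    simp [hs₀, eval_block, Instr.run, h1]
  have h25 : s₀.reg 25 = src + n := by simp [hs₀, eval_block, Instr.run, h24, h.size]
  have hm : s₀.mem = s.mem := eval_mem_of_readOnly (by decide)
  have hloop := eval_loop_invariant (c := 14) (b := 2) (m := n) (s := s₀) (P := walkEntryProg)
    (by decide) (by rw [hr _ (by decide), h.size])
    (fun i s' => (∀ v < i, s'.mem (src + n + v) =
        ∑ w ∈ Finset.range n, if p v w then f w else 0) ∧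
      ∀ a < src + n, s'.mem a = s.mem a)
    ⟨fun v hv => by omega, fun a _ => by rw [loopInit_mem, hm]⟩ (by
    rintro i hi s' hf hc ⟨h1, h2⟩
    have hctx : Ctx p n s' := h.of_eq (by rw [hf _ (by decide), hr _ (by decide)])
      (by rw [hf _ (by decide), hr _ (by decide)])
      (by rw [hf _ (by decide), hr _ (by decide)]) (fun a ha => h2 a (by omega))
    have hspec := hctx.walkEntryProg_spec hi hc
      (show s'.reg 24 = src by rw [hf _ (by decide), hr _ (by decide), h24])
      (fun w hw => (h2 _ (by omega)).trans (hsrc w hw))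
    rw [hf 25 (by decide), h25] at hspec
    rw [loopNext_mem]
    refine ⟨fun v hv => ?_, fun a ha => ?_⟩
    · rw [hspec]
      by_cases hvi : v = i
      · rw [if_pos (by omega), hvi]
      · rw [if_neg (by omega), h1 v (by omega)]
    · rw [hspec, if_neg (by omega), h2 a ha])
  have hfr : ∀ r ∉ (loop 14 2 walkEntryProg).writes, _ :=
    fun r hr => eval_reg_of_notMem (s := s₀) hr
  revert hloop hfr
  generalize CountProgram.eval (loop 14 2 _) s₀ = s₁
  rintro ⟨h1, h2⟩ hfr
  have h25' : s₁.reg 25 = src + n := by rw [hfr _ (by decide), h25]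
  have h26 : s₁.reg 26 = s.reg 26 := by rw [hfr _ (by decide), hr _ (by decide)]
  simpa [eval_block, Instr.run, h25', h26] using ⟨h1, h2⟩

open Classical in
theorem Ctx.oddLoopProg_spec (h : Ctx p n s) {u : ℕ} (hu : u < n) (h22 : s.reg 22 = u) :
    (oddLoopProg.eval s).reg 13 = (if OddLoop p n u n then u else s.reg 13) ∧
      ∀ a < 2 + n * n + n, (oddLoopProg.eval s).mem a = s.mem a := by
  rw [oddLoopProg, eval_seq]
  obtain ⟨i24, i26, im, ib⟩ := h.walkInitProg_spec h22
  have hr : ∀ r ∉ walkInitProg.writes, (walkInitProg.eval s).reg r = s.reg r :=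
    fun r hr => eval_reg_of_notMem hr
  revert i24 i26 im ib hr
  generalize walkInitProg.eval s = s₀
  intro i24 i26 im ib hr
  have hloop := eval_loop_invariant (c := 23) (b := 2) (m := n) (s := s₀)
    (P := .seq walkRowProg
      (.branch 26 (.seq (block [.add 20 24 22, .load 19 20])
        (.branch 19 (block [.copy 13 22]) (block []))) (block [])))
    (by decide) (by rw [hr _ (by decide), h.size])
    -- Register `24` is the address of row `i`, register `26` the parity of the walk length `i`.
    (fun i s' => s'.reg 24 = 2 + n * n + n + i * n ∧ s'.reg 26 = i % 2 ∧
      (∀ v < n, s'.mem (2 + n * n + n + i * n + v) = walkCount p n u i v) ∧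
      s'.reg 13 = (if OddLoop p n u i then u else s.reg 13) ∧
      ∀ a < 2 + n * n + n, s'.mem a = s.mem a)
    (by
      simp only [loopInit_reg (c := 23) (r := 24) (by decide) (by decide),
        loopInit_reg (c := 23) (r := 26) (by decide) (by decide),
        loopInit_reg (c := 23) (r := 13) (by decide) (by decide), loopInit_mem]
      refine ⟨by omega, i26, by simpa using im, ?_, ib⟩
      rw [if_neg (by rintro ⟨j, hj, -⟩; omega), hr _ (by decide)])
    (by
    rintro i hi s' hf hc ⟨h24, h26, hmem, h13, hb⟩
    have hctx : Ctx p n s' := h.of_eq (by rw [hf _ (by decide), hr _ (by decide)])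
      (by rw [hf _ (by decide), hr _ (by decide)])
      (by rw [hf _ (by decide), hr _ (by decide)]) hb
    have h22' : s'.reg 22 = u := by rw [hf _ (by decide), hr _ (by decide), h22]
    obtain ⟨r24, r26, rm, rb⟩ := hctx.walkRowProg_spec h24 (by omega) hmem
    have r22 : (walkRowProg.eval s').reg 22 = u :=
      (eval_reg_of_notMem (by decide)).trans h22'
    have r13 : (walkRowProg.eval s').reg 13 = s'.reg 13 := eval_reg_of_notMem (by decide)
    simp only [loopNext_reg (c := 23) (r := 24) (by decide) (by decide),
      loopNext_reg (c := 23) (r := 26) (by decide) (by decide),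
      loopNext_reg (c := 23) (r := 13) (by decide) (by decide), loopNext_mem, eval_seq]
    revert r24 r26 rm rb r22 r13
    generalize walkRowProg.eval s' = s₁
    intro r24 r26 rm rb r22 r13
    have hru := rm u hu
    have hro : ∀ P : CountProgram, P.readOnly = true → ∀ s, (P.eval s).mem = s.mem :=
      fun P hP s => eval_mem_of_readOnly hP
    have hodd : OddLoop p n u (i + 1) ↔
        OddLoop p n u i ∨ ((i + 1) % 2 = 1 ∧ walkCount p n u (i + 1) u ≠ 0) := by
      simp only [OddLoop, Nat.exists_lt_succ_right, Nat.odd_iff]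
    refine ⟨?_, ?_, fun v hv => ?_, ?_, fun a ha => ?_⟩
    · rw [eval_reg_of_notMem (by decide), r24]; ring
    · rw [eval_reg_of_notMem (by decide), r26, h26]; omega
    · rw [hro _ (by decide), walkCount, ← rm v hv]
      congr 1; ring
    · have h1 : 1 - i % 2 = (i + 1) % 2 := by omega
      rw [h26, h1] at r26
      have hw : s₁.mem (2 + n * n + n + i * n + n + u) = walkCount p n u (i + 1) u := by
        rw [hru, walkCount]
      simp only [eval_seq, eval_branch, eval_block, List.foldl, Instr.run]
      simp [r26, r24, r22, hw, hodd]
      rcases Nat.mod_two_eq_zero_or_one (i + 1) with h2 | h2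
      · simp [h2, r13, h13]
      · by_cases h3 : walkCount p n u (i + 1) u = 0
        · simp [h2, h3, r13, h13]
        · simp [h2, h3]
    · rw [hro _ (by decide), rb a (by omega), hb a ha])
  exact hloop.2.2.2

theorem Ctx.targetProg_spec (h : Ctx p n s) :
    (targetProg.eval s).reg 13 = target p n (s.reg 11) ∧
      ∀ a < 2 + n * n + n, (targetProg.eval s).mem a = s.mem a := by
  classical
  rw [targetProg, eval_seq, eval_seq]
  have h13 := h.degreeTargetProg_spec
  have hm := degreeTargetProg_mem (s := s)
  have hr : ∀ r ∉ degreeTargetProg.writes, (degreeTargetProg.eval s).reg r = s.reg r :=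
    fun r hr => eval_reg_of_notMem hr
  revert h13 hm hr
  generalize degreeTargetProg.eval s = s₁
  intro h13 hm hr
  -- Because of this bound, a truncated difference of zero means that the target equals `n`. The
  -- same value `n` then starts the search for an odd target.
  have hle := degreeTarget_le (p := p) (n := n) (d := s.reg 11)
  set s₂ := (block [.sub 19 2 13]).eval s₁ with hs₂
  have h19 : s₂.reg 19 = n - degreeTarget p n (s.reg 11) n := by
    simp [hs₂, eval_block, Instr.run, h13, hr 2 (by decide), h.size]
  have hr2 : ∀ r, r ≠ 19 → s₂.reg r = s₁.reg r := fun r h1 => by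
    simp [hs₂, eval_block, Instr.run, h1]
  have hm2 : s₂.mem = s.mem := (eval_mem_of_readOnly (by decide)).trans hm
  rw [eval_branch, target]
  by_cases hT : degreeTarget p n (s.reg 11) n = n
  · rw [if_pos hT, if_neg (by omega)]
    refine eval_loop_invariant (m := n) (by decide)
      (by rw [hr2 _ (by decide), hr _ (by decide), h.size])
      (fun i s' => s'.reg 13 = oddTarget p n i ∧ ∀ a < 2 + n * n + n, s'.mem a = s.mem a) ?_ ?_
    · rw [loopInit_reg (by decide) (by decide), loopInit_mem, hr2 _ (by decide), h13, hm2]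
      exact ⟨hT, fun _ _ => rfl⟩
    · rintro i hi s' hf hc ⟨hI, hmem⟩
      have hctx : Ctx p n s' := h.of_eq
        (by rw [hf _ (by decide), hr2 _ (by decide), hr _ (by decide)])
        (by rw [hf _ (by decide), hr2 _ (by decide), hr _ (by decide)])
        (by rw [hf _ (by decide), hr2 _ (by decide), hr _ (by decide)]) hmem
      obtain ⟨h1, h2⟩ := hctx.oddLoopProg_spec hi hc
      rw [loopNext_reg (by decide) (by decide), loopNext_mem, h1, hI, oddTarget]
      exact ⟨rfl, fun a ha => (h2 a ha).trans (hmem a ha)⟩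
  · rw [if_neg hT, if_pos (by omega)]
    exact ⟨by rw [eval_reg_of_notMem (by decide), hr2 13 (by decide), h13],
      fun a _ => by rw [eval_mem_of_readOnly (by decide), hm2]⟩

/-- Division by counting: register `11` counts modulo 4 and register `12` the carries. All `R_4`
rounds are run, but only those with counter below `R_9` have an effect, whence `min`. -/
theorem digitProg_spec (h : s.reg 9 ≤ s.reg 4) :
    (digitProg.eval s).reg 11 = s.reg 9 % 4 ∧ (digitProg.eval s).reg 9 = s.reg 9 / 4 := by
  rw [digitProg, eval_seq, eval_seq]
  set s₀ := (block [.const 11 0, .const 12 0]).eval s with hs₀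
  have hr : ∀ r, r ≠ 11 → r ≠ 12 → s₀.reg r = s.reg r := fun r h1 h2 => by
    simp [hs₀, eval_block, Instr.run, h1, h2]
  have hloop := eval_loop_invariant (c := 29) (b := 4) (s := s₀)
    (P := .seq (block [.sub 19 9 29])
      (.branch 19 (.seq (block [.const 19 1, .add 11 11 19, .const 19 3, .sub 19 11 19])
        (.branch 19 (block [.const 11 0, .const 19 1, .add 12 12 19]) (block []))) (block [])))
    (by decide) rfl
    (fun i s' => s'.reg 11 = min i (s.reg 9) % 4 ∧ s'.reg 12 = min i (s.reg 9) / 4)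
    (by simp [loopInit_reg, hs₀, eval_block, Instr.run]) (by
    rintro i hi s' hf hc ⟨h11, h12⟩
    have h9 : s'.reg 9 = s.reg 9 := by rw [hf _ (by decide), hr _ (by decide) (by decide)]
    rw [loopNext_reg (by decide) (by decide), loopNext_reg (by decide) (by decide)]
    simp only [eval_seq, eval_branch, eval_block, List.foldl, Instr.run]
    simp [h9, hc, h11, h12]
    split_ifs <;> simp [*] <;> omega)
  rw [hr 4 (by decide) (by decide), min_eq_right h] at hloop
  revert hloop
  generalize CountProgram.eval (loop 29 4 _) s₀ = s₁
  rintro ⟨h1, h2⟩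
  simp [eval_block, Instr.run, h1, h2]

end

/-! ### Correctness of rounds, branches and the whole search -/

section

variable {n : ℕ} {G : SimpleGraph (Fin n)} {s : State}

theorem residualAdj_insert {D : Finset ℕ} {t v w : ℕ} :
    residualAdj G (insert t D) v w ↔ residualAdj G D v w ∧ v ≠ t ∧ w ≠ t := by
  simp only [residualAdj, residual, SimpleGraph.isolate]
  simp
  tauto

theorem roundProg_spec {x : ℕ × Finset ℕ × ℕ} (h : Ctx (residualAdj G x.2.1) n s)
    (h9 : s.reg 9 = x.1) (h4 : x.1 ≤ s.reg 4) :
    (roundProg.eval s).reg 9 = (searchStep G x).1 ∧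
      Ctx (residualAdj G (searchStep G x).2.1) n (roundProg.eval s) ∧
      (roundProg.eval s).reg 13 = (searchStep G x).2.2 ∧
      ∀ a < 2 + n * n, (roundProg.eval s).mem a = s.mem a := by
  rw [roundProg, eval_seq, eval_seq]
  obtain ⟨d11, d9⟩ := digitProg_spec (h9 ▸ h4)
  have dm : (digitProg.eval s).mem = s.mem := eval_mem_of_readOnly (by decide)
  have dr : ∀ r ∉ digitProg.writes, (digitProg.eval s).reg r = s.reg r :=
    fun r hr => eval_reg_of_notMem hr
  revert d11 d9 dm dr
  generalize digitProg.eval s = s₁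
  intro d11 d9 dm dr
  rw [h9] at d11 d9
  have hctx : Ctx (residualAdj G x.2.1) n s₁ := h.of_eq (dr _ (by decide)) (dr _ (by decide))
    (dr _ (by decide)) (fun a _ => by rw [dm])
  obtain ⟨t13, tm⟩ := hctx.targetProg_spec
  have tr : ∀ r ∉ targetProg.writes, (targetProg.eval s₁).reg r = s₁.reg r :=
    fun r hr => eval_reg_of_notMem hr
  revert t13 tm tr
  generalize targetProg.eval s₁ = s₂
  intro t13 tm tr
  rw [d11] at t13
  have t5 : s₂.reg 5 = 2 + n * n := (tr 5 (by decide)).trans hctx.alive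
  simp only [searchStep]
  set T := target (residualAdj G x.2.1) n (x.1 % 4)
  have hctx₂ : Ctx (residualAdj G x.2.1) n s₂ := hctx.of_eq (tr _ (by decide)) (tr _ (by decide))
    (tr _ (by decide)) tm
  simp only [eval_block, List.foldl, Instr.run]
  refine ⟨?_, ⟨?_, ?_, ?_, fun v hv w hw => ?_⟩, ?_, fun a ha => ?_⟩
  · simpa [tr 9 (by decide)] using d9
  · simpa using hctx₂.size
  · simpa using hctx₂.alive
  · simpa using hctx₂.table
  · have : v * n + n ≤ n * n := by nlinarith
    -- If `T = n`, the zero is stored in the first cell of the table of walks, on which `Ctx`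
    -- imposes nothing.
    rw [residualAdj_insert, ← hctx₂.adj v hv w hw]
    simp only [State.setMem_mem, State.setReg_mem, State.setReg_reg]
    have hne : 2 + v * n + w ≠ 2 + n * n + T := by omega
    simp [t5, t13, hne]
    tauto
  · simpa using t13
  · simp [t5, t13]
    rw [if_neg (by omega), tm a (by omega), dm]

open Classical in
theorem branchProg_spec {k : ℕ} (h2 : s.reg 2 = n) (h3 : s.reg 3 = k + 1)
    (h5 : s.reg 5 = 2 + n * n) (h6 : s.reg 6 = 2 + n * n + n) (h8 : s.reg 8 ≤ s.reg 4)
    (hadj : ∀ v w : Fin n, s.mem (2 + v * n + w) ≠ 0 ↔ G.Adj v w) :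
    (branchProg.eval s).reg 0 =
        (if ((searchStep G)^[k + 1] (s.reg 8, ∅, 0)).2.2 = n then 1 else s.reg 0) ∧
      ∀ a < 2 + n * n, (branchProg.eval s).mem a = s.mem a := by
  rw [branchProg, eval_seq, eval_seq, eval_seq]
  have hinit := eval_loop_invariant (c := 14) (b := 2) (s := s)
    (P := block [.const 19 1, .add 20 5 14, .store 20 19]) (by decide) h2
    (fun i s' => (∀ v < i, s'.mem (2 + n * n + v) = 1) ∧
      ∀ a < 2 + n * n, s'.mem a = s.mem a) ⟨fun v hv => by omega, fun a _ => rfl⟩ (by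
    rintro i hi s' hf hc ⟨h1, hb⟩
    rw [loopNext_mem]
    simp [eval_block, Instr.run, hc, hf 5 (by decide), h5]
    refine ⟨fun v hv hne => h1 v (by omega), fun a ha => ?_⟩
    rw [if_neg (by omega), hb a ha])
  have ir : ∀ r ∉ (loop 14 2 (block [.const 19 1, .add 20 5 14, .store 20 19])).writes, _ :=
    fun r hr => eval_reg_of_notMem (s := s) hr
  revert hinit ir
  generalize CountProgram.eval (loop 14 2 _) s = s₁
  rintro ⟨ia, ib⟩ ir
  set s₂ := (block [.copy 9 8]).eval s₁ with hs₂
  have cr : ∀ r, r ≠ 9 → s₂.reg r = s₁.reg r := fun r h1 => by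
    simp [hs₂, eval_block, Instr.run, h1]
  have cm : s₂.mem = s₁.mem := eval_mem_of_readOnly (by decide)
  have c9 : s₂.reg 9 = s.reg 8 := by
    simpa [hs₂, eval_block, Instr.run] using ir 8 (by decide)
  have hctx : Ctx (residualAdj G ∅) n s₂ := by
    refine ⟨?_, ?_, ?_, fun v hv w hw => ?_⟩
    · rw [cr _ (by decide), ir _ (by decide), h2]
    · rw [cr _ (by decide), ir _ (by decide), h5]
    · rw [cr _ (by decide), ir _ (by decide), h6]
    · have : v * n + n ≤ n * n := by nlinarith
      rw [cm, ia v hv, ia w hw, ib _ (by omega)]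
      have := hadj ⟨v, hv⟩ ⟨w, hw⟩
      dsimp only at this
      rw [this]
      simp [residualAdj, residual, SimpleGraph.isolate, hv, hw]
  have hround := eval_loop_invariant (c := 10) (b := 3) (s := s₂) (P := roundProg) (m := k + 1)
    (by decide) (by rw [cr _ (by decide), ir _ (by decide), h3])
    -- The bound by `s.reg 4` guarantees that the digit loop runs long enough in every round.
    (fun i s' => s'.reg 9 = ((searchStep G)^[i] (s.reg 8, ∅, s₂.reg 13)).1 ∧
      ((searchStep G)^[i] (s.reg 8, ∅, s₂.reg 13)).1 ≤ s.reg 4 ∧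
      Ctx (residualAdj G ((searchStep G)^[i] (s.reg 8, ∅, s₂.reg 13)).2.1) n s' ∧
      s'.reg 13 = ((searchStep G)^[i] (s.reg 8, ∅, s₂.reg 13)).2.2 ∧
      ∀ a < 2 + n * n, s'.mem a = s.mem a)
    (by
      refine ⟨?_, h8, ?_, ?_, fun a ha => ?_⟩
      · rw [loopInit_reg (by decide) (by decide), c9]; rfl
      · exact hctx.of_eq (loopInit_reg (by decide) (by decide))
          (loopInit_reg (by decide) (by decide)) (loopInit_reg (by decide) (by decide))
          fun _ _ => rfl
      · rw [loopInit_reg (by decide) (by decide)]; rfl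
      · rw [loopInit_mem, cm, ib a ha])
    (by
      rintro i hi s' hf hc ⟨r9, r4, rctx, r13, rm⟩
      rw [Function.iterate_succ_apply']
      have h4' : s'.reg 4 = s.reg 4 := by
        rw [hf _ (by decide), cr _ (by decide), ir _ (by decide)]
      obtain ⟨q9, qctx, q13, qm⟩ := roundProg_spec rctx r9 (h4' ▸ r4)
      refine ⟨?_, ?_, ?_, ?_, fun a ha => ?_⟩
      · rw [loopNext_reg (by decide) (by decide), q9]
      · exact (Nat.div_le_self _ _).trans r4
      · exact qctx.of_eq (loopNext_reg (by decide) (by decide))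
          (loopNext_reg (by decide) (by decide)) (loopNext_reg (by decide) (by decide))
          fun _ _ => rfl
      · rw [loopNext_reg (by decide) (by decide), q13]
      · rw [loopNext_mem, qm a ha, rm a ha])
  have rr : ∀ r ∉ (loop 10 3 roundProg).writes, _ :=
    fun r hr => eval_reg_of_notMem (s := s₂) hr
  revert hround rr
  generalize CountProgram.eval (loop 10 3 _) s₂ = s₃
  rintro ⟨-, -, -, f13, fm⟩ rr
  -- A round ignores the vertex deleted last, so the value left in register `13` by an earlier
  -- branch is harmless.
  have hstart : (searchStep G)^[k + 1] (s.reg 8, ∅, s₂.reg 13) =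
      (searchStep G)^[k + 1] (s.reg 8, ∅, 0) := by
    rw [Function.iterate_succ_apply, Function.iterate_succ_apply]; rfl
  rw [hstart] at f13
  have f2 : s₃.reg 2 = n := by rw [rr _ (by decide), hctx.size]
  have f0 : s₃.reg 0 = s.reg 0 := by
    rw [rr _ (by decide), cr _ (by decide), ir _ (by decide)]
  have hle : ((searchStep G)^[k + 1] (s.reg 8, ∅, 0)).2.2 ≤ n := by
    rw [Function.iterate_succ_apply']
    exact target_le _ _ _
  refine ⟨?_, fun a ha => by rw [eval_mem_of_readOnly (by decide), fm a ha]⟩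
  simp only [eval_seq, eval_branch, eval_block, List.foldl, Instr.run]
  revert f13 hle
  generalize ((searchStep G)^[k + 1] (s.reg 8, ∅, 0)).2.2 = t
  intro f13 hle
  simp [f2, f13]
  split_ifs <;> first | omega | simp [f0]

open Classical in
theorem mainProg_spec {k : ℕ} (h0 : s.reg 0 = 0) (h2 : s.reg 2 = n) (h3 : s.reg 3 = k + 1)
    (h5 : s.reg 5 = 2 + n * n) (h6 : s.reg 6 = 2 + n * n + n)
    (hadj : ∀ v w : Fin n, s.mem (2 + v * n + w) ≠ 0 ↔ G.Adj v w) :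
    (mainProg.eval s).reg 0 =
      if ∃ q < s.reg 4, ((searchStep G)^[k + 1] (q, ∅, 0)).2.2 = n then 1 else 0 := by
  refine (eval_loop_invariant (by decide) rfl
    (fun i s' => s'.reg 0 =
        (if ∃ q < i, ((searchStep G)^[k + 1] (q, ∅, 0)).2.2 = n then 1 else 0) ∧
      ∀ a < 2 + n * n, s'.mem a = s.mem a) ?_ ?_).1
  · rw [loopInit_reg (by decide) (by decide), loopInit_mem, h0]
    simp
  · rintro i hi s' hf hc ⟨hI, hm⟩
    obtain ⟨b0, bm⟩ := branchProg_spec (G := G) (s := s') (k := k)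
      (by rw [hf _ (by decide), h2]) (by rw [hf _ (by decide), h3])
      (by rw [hf _ (by decide), h5]) (by rw [hf _ (by decide), h6])
      (by rw [hf 4 (by decide), hc]; exact hi.le) (fun v w => by
        have : (v : ℕ) * n + n ≤ n * n := by have := v.2; nlinarith
        rw [hm _ (by omega)]
        exact hadj v w)
    rw [loopNext_reg (by decide) (by decide), loopNext_mem, b0, hc, hI]
    refine ⟨?_, fun a ha => (bm a ha).trans (hm a ha)⟩
    have hor : ∀ (A B : Prop) [Decidable A] [Decidable B] [Decidable (A ∨ B)],
        (if B then 1 else if A then 1 else 0) = if A ∨ B then 1 else 0 := by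
      intro A B _ _ _
      by_cases hA : A <;> by_cases hB : B <;> simp [hA, hB]
    simp only [Nat.exists_lt_succ_right]
    exact hor _ _

theorem initProg_spec :
    (initProg.eval s).reg 0 = 0 ∧ (initProg.eval s).reg 2 = s.mem 0 ∧
      (initProg.eval s).reg 3 = s.mem 1 + 1 ∧ (initProg.eval s).reg 4 = 4 ^ (s.mem 1 + 1) ∧
      (initProg.eval s).reg 5 = 2 + s.mem 0 * s.mem 0 ∧
      (initProg.eval s).reg 6 = 2 + s.mem 0 * s.mem 0 + s.mem 0 ∧
      (initProg.eval s).mem = s.mem := by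
  -- Two doublings per round multiply by four.
  have hpow : ∀ s : State, ((loop 10 3 (block [.add 4 4 4, .add 4 4 4])).eval s).reg 4 =
      s.reg 4 * 4 ^ s.reg 3 := fun s =>
    eval_loop_invariant (by decide) rfl (fun i s' => s'.reg 4 = s.reg 4 * 4 ^ i)
      (by simp [loopInit_reg]) fun i _ s' hf hc hI => by
        rw [loopNext_reg (by decide) (by decide)]
        simp [eval_block, Instr.run, hI]
        ring
  have hmul : ∀ s : State, ((loop 14 2 (block [.add 5 5 2])).eval s).reg 5 =
      s.reg 5 + s.reg 2 * s.reg 2 := fun s =>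
    eval_loop_invariant (by decide) rfl (fun i s' => s'.reg 5 = s.reg 5 + i * s.reg 2)
      (by simp [loopInit_reg]) fun i _ s' hf hc hI => by
        rw [loopNext_reg (by decide) (by decide)]
        simp [eval_block, Instr.run, hI, hf 2 (by decide)]
        ring
  refine ⟨?_, ?_, ?_, ?_, ?_, ?_, eval_mem_of_readOnly (by decide)⟩ <;>
  · simp only [initProg, readProg, setupProg, eval_seq, eval_block, List.foldl, Instr.run]
    simp (disch := decide) [eval_reg_of_notMem, hpow, hmul]

end

/-! ### Running time and conclusion -/

theorem eval_le_eval (p : Polynomial ℕ) {a b : ℕ} (h : a ≤ b) : p.eval a ≤ p.eval b := by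
  rw [Polynomial.eval_eq_sum, Polynomial.eval_eq_sum]
  exact Finset.sum_le_sum fun i _ => Nat.mul_le_mul_left _ (Nat.pow_le_pow_left h i)

/-- The running time. -/
theorem exists_exec : ∃ q : Polynomial ℕ, ∀ s : State,
    ∃ t ≤ (s.mem 1 + 1) * (4 ^ (s.mem 1 + 1)) ^ 2 * (80 + 14 * s.mem 0 + q.eval (s.mem 0)),
      Exec (.seq readProg.compile (.seq setupProg.compile mainProg.compile)) s t
        (mainProg.eval (initProg.eval s)) := by
  obtain ⟨q, hq⟩ := exists_polynomial_cost targetProg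
  refine ⟨q, fun s => ?_⟩
  set n := s.mem 0
  set K := s.mem 1 + 1 with hK
  set B := 4 ^ K with hB
  let β : ℕ → ℕ := fun r => if r = 2 then n else if r = 3 then K else B
  obtain ⟨-, h2, h3, h4, -⟩ := initProg_spec (s := s)
  have hr2 : (readProg.eval s).reg 2 = n := by simp [readProg, eval_block, Instr.run, n]
  have hr3 : (readProg.eval s).reg 3 = K := by simp [readProg, eval_block, Instr.run, K]
  have hread : ∀ r ∈ readProg.bounds, s.reg r ≤ β r := by
    simp [readProg, block, CountProgram.bounds]
  have hsetup : ∀ r ∈ setupProg.bounds, (readProg.eval s).reg r ≤ β r := by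
    intro r hr
    have : r = 3 ∨ r = 2 := by simpa [setupProg, block, CountProgram.bounds] using hr
    rcases this with rfl | rfl
    · exact hr3.le
    · exact hr2.le
  have hmain : ∀ r ∈ mainProg.bounds, (initProg.eval s).reg r ≤ β r := by
    intro r hr
    have : ∀ r ∈ mainProg.bounds, r = 2 ∨ r = 3 ∨ r = 4 := by decide
    rcases this r hr with rfl | rfl | rfl
    · exact h2.le
    · exact h3.le
    · exact h4.le
  -- Three stages are timed separately: loop bounds are computed by earlier stages, and
  -- `exec_compile` forbids a program to write its own bounds.
  obtain ⟨t₁, ht₁, e₁⟩ := exec_compile (by decide) (by decide) hread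
  obtain ⟨t₂, ht₂, e₂⟩ := exec_compile (by decide) (by decide) hsetup
  obtain ⟨t₃, ht₃, e₃⟩ := exec_compile (by decide) (by decide) hmain
  refine ⟨t₁ + (t₂ + t₃), ?_, .seq e₁ (.seq e₂ e₃)⟩
  have htarget : targetProg.cost β = q.eval n := by
    rw [← hq]
    have : ∀ r ∈ targetProg.bounds, r = 2 := by decide
    exact cost_congr fun r hr => by rw [this r hr]; rfl
  have hcost : readProg.cost β + (setupProg.cost β + mainProg.cost β) =
      20 + 7 * K + 16 * (K * B) + K * B * q.eval n + 19 * (K * B ^ 2) + 6 * n + 8 * (n * B) +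
        18 * B := by
    simp only [readProg, setupProg, mainProg, cost, block, branchProg, roundProg, digitProg,
      htarget, β, if_true, Nat.reduceEqDiff, if_false]
    ring
  have hK1 : 1 ≤ K := by omega
  have hB1 : 1 ≤ B := Nat.one_le_pow _ _ (by norm_num)
  -- Every monomial is absorbed into `K * B ^ 2`: the constants 20, 7, 16, 19 and 18 add up to 80,
  -- the coefficients 6 and 8 of `n` to 14.
  have hKB : K * B ≤ K * B ^ 2 := by nlinarith [Nat.mul_le_mul_left (K * B) hB1]
  have hKK : K ≤ K * B ^ 2 := le_trans (Nat.le_mul_of_pos_right K hB1) hKB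
  have hBB : B ≤ K * B ^ 2 := le_trans (Nat.le_mul_of_pos_left B hK1) hKB
  have hnB := Nat.mul_le_mul_left n hBB
  have hn1 := Nat.mul_le_mul_left n (hK1.trans hKK)
  have hqB := Nat.mul_le_mul_right (q.eval n) hKB
  calc t₁ + (t₂ + t₃) ≤ readProg.cost β + (setupProg.cost β + mainProg.cost β) := by omega
    _ ≤ _ := by
      rw [hcost]
      nlinarith

/-- The program answers correctly. -/
theorem eval_encode (x : GraphBudget) :
    (x.Yes → (mainProg.eval (initProg.eval (initial x.encode))).reg 0 = 1) ∧
      (¬ x.Yes → (mainProg.eval (initProg.eval (initial x.encode))).reg 0 = 0) := by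
  classical
  obtain ⟨h0, h2, h3, h4, h5, h6, hm⟩ := initProg_spec (s := initial x.encode)
  have m0 : (initial x.encode).mem 0 = x.n := by simp [initial, GraphBudget.encode]
  have m1 : (initial x.encode).mem 1 = x.k := by simp [initial, GraphBudget.encode]
  rw [m0] at h2 h5 h6
  rw [m1] at h3 h4
  have hadj : ∀ v w : Fin x.n,
      (initProg.eval (initial x.encode)).mem (2 + v * x.n + w) ≠ 0 ↔ x.G.Adj v w := by
    intro v w
    rw [hm]
    have e := finProdFinEquiv.symm_apply_apply (v, w)
    simp only [finProdFinEquiv_symm_apply, Prod.mk.injEq] at e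
    have hval : ((finProdFinEquiv (v, w) : Fin (x.n * x.n)) : ℕ) = v * x.n + w := by
      simp [finProdFinEquiv, add_comm, mul_comm]
    have hlt := (finProdFinEquiv (v, w)).2
    rw [hval] at hlt
    have hfin : (⟨v * x.n + w, hlt⟩ : Fin (x.n * x.n)) = finProdFinEquiv (v, w) :=
      Fin.ext hval.symm
    rw [show 2 + (v : ℕ) * x.n + w = v * x.n + w + 1 + 1 by ring]
    simp [initial, GraphBudget.encode, List.getD_eq_getElem?_getD, hlt, hfin,
      e.1, e.2]
  rw [mainProg_spec h0 h2 h3 h5 h6 hadj, yes_iff_search, h4]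
  exact ⟨fun h => if_pos h, fun h => if_neg h⟩

/-- Since `k + 1 ≤ 2 ^ k`, it suffices to compare exponents: `k + 4 * (k + 1) ≤ (k + 1) ^ 2 + k + 4`
amounts to `0 ≤ (k - 1) ^ 2`. The extra 4 is the factor 16. -/
theorem bound_le (k : ℕ) : (k + 1) * (4 ^ (k + 1)) ^ 2 ≤ 2 ^ ((k + 1) ^ 2 + k) * 16 := by
  calc (k + 1) * (4 ^ (k + 1)) ^ 2 ≤ 2 ^ k * (4 ^ (k + 1)) ^ 2 :=
        Nat.mul_le_mul_right _ Nat.lt_two_pow_self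
    _ = 2 ^ (k + 2 * ((k + 1) * 2)) := by
        rw [show (4 : ℕ) = 2 ^ 2 by norm_num, ← pow_mul, ← pow_mul, ← pow_add]
    _ ≤ 2 ^ ((k + 1) ^ 2 + k + 4) := by
        refine Nat.pow_le_pow_right (by norm_num) ?_
        zify
        nlinarith [sq_nonneg ((k : ℤ) - 1)]
    _ = _ := by rw [pow_add]; norm_num

/-- Each of the `n * n + 2` entries contributes at least its separator. -/
theorem size_le_inputSize (x : GraphBudget) : x.n ≤ inputSize x.encode := by
  have h1 : (x.encode.map fun a => Nat.size a + 1).length ≤ inputSize x.encode :=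
    List.length_le_sum_of_one_le _ fun i hi => by
      obtain ⟨a, -, rfl⟩ := List.mem_map.1 hi
      omega
  have h2 : (x.encode.map fun a => Nat.size a + 1).length = x.n * x.n + 2 := by
    simp [GraphBudget.encode]
  have h3 := Nat.le_mul_self x.n
  omega

theorem solvableInFPTTime :
    vertexDeletionTwoEdgeColoring.SolvableInFPTTime fun k => 2 ^ ((k + 1) ^ 2 + k) := by
  obtain ⟨q, hq⟩ := exists_exec
  refine ⟨16 * (80 + 14 * .X + q),
    .seq readProg.compile (.seq setupProg.compile mainProg.compile), fun (x : GraphBudget) => ?_⟩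
  obtain ⟨t, ht, hex⟩ := hq (initial x.encode)
  refine ⟨t, _, hex, ht.trans ?_, eval_encode x⟩
  have m0 : (initial x.encode).mem 0 = x.n := by simp [initial, GraphBudget.encode]
  have m1 : (initial x.encode).mem 1 = x.k := by simp [initial, GraphBudget.encode]
  rw [m0, m1]
  have hmono := eval_le_eval (80 + 14 * .X + q) (size_le_inputSize x)
  simp only [Polynomial.eval_add, Polynomial.eval_mul, Polynomial.eval_X,
    Polynomial.eval_ofNat] at hmono ⊢
  rw [← mul_assoc]
  exact Nat.mul_le_mul (bound_le x.k) hmono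

theorem computable_bound : Computable fun k : ℕ => 2 ^ ((k + 1) ^ 2 + k) := by
  have hpow : Primrec₂ fun a b : ℕ => a ^ b := Primrec₂.unpaired'.1 Nat.Primrec.pow
  exact (hpow.comp (.const 2) (Primrec.nat_add.comp
    (hpow.comp Primrec.succ (.const 2)) .id)).to_comp

end BranchingSearch

theorem mainTheorem12 :
    vertexDeletionTwoEdgeColoring.IsFPT ∧
      vertexDeletionTwoEdgeColoring.SolvableInFPTTime (fun k => 2 ^ ((k + 1) ^ 2 + k)) :=
  ⟨⟨_, BranchingSearch.computable_bound, BranchingSearch.solvableInFPTTime⟩,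
    BranchingSearch.solvableInFPTTime⟩
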